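/- Let $\Upsilon\subseteq\mathbb R^m$ and $\Theta\subseteq\mathbb R^q$ be open, let $G:\Upsilon\times\Theta\to\mathbb R^n$ be three times continuously differentiable, and suppose that at every $(u,\theta)\in\Upsilon\times\Theta$ the $n\times m$ Jacobian $\nabla_uG(u,\theta)$ has full row rank $n$ and the $n\times q$ Jacobian $\nabla_\theta G(u,\theta)$ has full column rank $q$. Fix $y\in\mathbb R^n$ and suppose that for every $u\in\Upsilon$ the function $\vartheta\mapsto\|G(u,\vartheta)-y\|$ (Euclidean norm) attains its minimum over $\Theta$ at exactly one point, denoted $\hat\theta(y,u)$. Put $$\mathcal G(y)=\{(u,\theta)\in\Upsilon\times\Theta: G(u,\theta)=y\},\qquad \mathcal U(y)=\Big\{u\in\Upsilon:\min_{\vartheta\in\Theta}\|G(u,\vartheta)-y\|=0\Big\}.$$ Then the following hold. 1. $\mathcal G(y)$ is an embedded $C^2$ submanifold of $\mathbb R^{m+q}$ of dimension $m+q-n$, and $\mathcal G(y)=\{(u,\hat\theta(y,u)):u\in\mathcal U(y)\}$. 2. For every choice of $n\times(n-q)$ matrices $\overline{\nabla_\theta G}(u,\theta)$, $(u,\theta)\in\Upsilon\times\Theta$,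 with orthonormal columns that are orthogonal to the columns of $\nabla_\theta G(u,\theta)$, $$\mathcal U(y)=\big\{u\in\Upsilon:\overline{\nabla_\theta G}(u,\hat\theta(y,u))^\top\,[G(u,\hat\theta(y,u))-y]=0\big\};$$ and for every point of $\Upsilon\times\Theta$ there is such a choice that is of class $C^2$ in $(u,\theta)$ on a neighbourhood of that point. 3. $\mathcal U(y)$, with a suitable topology, is a (possibly only immersed) $C^2$ submanifold of $\mathbb R^m$ of dimension $m+q-n$, and the projection $(u,\theta)\mapsto u$ is a $C^2$ diffeomorphism from $\mathcal G(y)$ onto $\mathcal U(y)$ with inverse $u\mapsto(u,\hat\theta(y,u))$. This topology is the subspace topology, so that $\mathcal U(y)$ is an embedded submanifold, if and only if $\hat\theta(y,\cdot)$ is continuous on $\mathcal U(y)$. 4. The Riemannian measures $\lambda_{\mathcal G(y)}$ and $\lambda_{\mathcal U(y)}$ that the Euclidean metrics of $\mathbb R^{m+q}$ and $\mathbb R^m$ induce on these submanifolds exist, are unique, and satisfy $\lambda_{\mathcal U(y)}(du)=D(u,\theta)^{-1/2}\lambda_{\mathcal G(y)}(du,d\theta)$, that is, for every Borel set $B\subseteq\mathbb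 R^m$, $$\lambda_{\mathcal U(y)}(B)=\int_{\{(u,\theta)\in\mathcal G(y):\,u\in B\}}D(u,\theta)^{-1/2}\,\lambda_{\mathcal G(y)}(du,d\theta),$$ where, with $\iota_q$ the $q\times q$ identity matrix, $$D(u,\theta)=\det\Big(\iota_q+\big[\nabla_\theta G(u,\theta)^\top(\nabla_uG(u,\theta)\nabla_uG(u,\theta)^\top)^{-1}\nabla_\theta G(u,\theta)\big]^{-1}\Big).$$ -/

import Mathlib

open Set MeasureTheory

noncomputable section

/-- `ℝ^k` with its Euclidean norm. -/
abbrev Eu (k : ℕ) : Type := EuclideanSpace ℝ (Fin k)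

/-- `ℝ^m × ℝ^q = ℝ^(m+q)` with its Euclidean norm. -/
abbrev EuProd (m q : ℕ) : Type := WithLp 2 (Eu m × Eu q)

/-! ### Submanifolds of a Euclidean space -/

section Submanifold

variable {F F' : Type*} [NormedAddCommGroup F] [InnerProductSpace ℝ F]
  [NormedAddCommGroup F'] [InnerProductSpace ℝ F']

/-- `φ : V → M` is a local parametrization of class `C^k` of the set `M`, equipped with the topology
`t` (not necessarily the subspace topology): `V` is open in `ℝ^d`, `φ` is an injective immersion of
class `C^k` into the ambient space, and it is a homeomorphism from `V` onto a `t`-open part of `M`. -/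
structure IsLocalParam (k : WithTop ℕ∞) (d : ℕ) (M : Set F) (t : TopologicalSpace M)
    (V : Set (Eu d)) (φ : Eu d → F) : Prop where
  isOpen : IsOpen V
  mapsTo : MapsTo φ V M
  injOn : InjOn φ V
  contDiffOn : ContDiffOn ℝ k φ V
  immersion : ∀ x ∈ V, Function.Injective (fderiv ℝ φ x)
  homeo : ∀ W ⊆ V, IsOpen W ↔ @IsOpen M t ((Subtype.val : M → F) ⁻¹' (φ '' W))

/-- `M` with the topology `t` is a (possibly only immersed) `d`-dimensional `C^k` submanifold of the
ambient space. Immersed submanifolds are allowed to carry a topology finer than the subspace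
topology; embedded ones carry the subspace topology. -/
structure IsSubmanifold (k : WithTop ℕ∞) (d : ℕ) (M : Set F) (t : TopologicalSpace M) : Prop where
  secondCountable : @SecondCountableTopology M t
  exists_param : ∀ p ∈ M, ∃ (V : Set (Eu d)) (φ : Eu d → F), IsLocalParam k d M t V φ ∧ p ∈ φ '' V

/-- The subspace topology of `M`. -/
abbrev subspaceTopology (M : Set F) : TopologicalSpace M := instTopologicalSpaceSubtype

/-- `M` is an embedded `d`-dimensional `C^k` submanifold of the ambient space. -/
def IsEmbeddedSubmanifold (k : WithTop ℕ∞) (d : ℕ) (M : Set F) : Prop :=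
  IsSubmanifold k d M (subspaceTopology M)

/-- `f` restricts to a map of class `C^k` from the submanifold `(M, t)` to the submanifold
`(N, s)`. -/
def IsCkMap (k : WithTop ℕ∞) (d : ℕ) (M : Set F) (t : TopologicalSpace M)
    (N : Set F') (s : TopologicalSpace N) (f : F → F') : Prop :=
  (∃ h : MapsTo f M N, @Continuous M N t s (h.restrict f M N)) ∧
    ∀ (V : Set (Eu d)) (φ : Eu d → F), IsLocalParam k d M t V φ → ContDiffOn ℝ k (f ∘ φ) V

/-- `f` and `g` restrict to mutually inverse `C^k` diffeomorphisms between the `d`-dimensional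
submanifolds `(M, t)` and `(N, s)`. -/
structure IsCkDiffeo (k : WithTop ℕ∞) (d : ℕ) (M : Set F) (t : TopologicalSpace M)
    (N : Set F') (s : TopologicalSpace N) (f : F → F') (g : F' → F) : Prop where
  toFun : IsCkMap k d M t N s f
  invFun : IsCkMap k d N s M t g
  invOn : InvOn g f M N

/-- The Riemannian volume density `√(det (g_ij))`, `g_ij = ⟪∂_i φ, ∂_j φ⟫`, of the metric that `φ`
pulls back from the ambient space. -/
def volumeDensity {d : ℕ} (φ : Eu d → F) (x : Eu d) : ℝ :=
  Real.sqrt (Matrix.det (Matrix.of fun i j : Fin d =>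
    inner ℝ (fderiv ℝ φ x (EuclideanSpace.single i 1)) (fderiv ℝ φ x (EuclideanSpace.single j 1))))

/-- `lam` is the Riemannian (intrinsic) measure of the `d`-dimensional submanifold `(M, t)`, regarded
as a measure on the ambient space: it lives on `M`, and in every local parametrization it is
`√(det (g_ij)) dx`. -/
structure IsRiemannianMeasure [MeasurableSpace F] (k : WithTop ℕ∞) (d : ℕ) (M : Set F)
    (t : TopologicalSpace M) (lam : Measure F) : Prop where
  compl_eq_zero : lam Mᶜ = 0
  image_eq : ∀ (V : Set (Eu d)) (φ : Eu d → F), IsLocalParam k d M t V φ →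
    ∀ A ⊆ V, MeasurableSet A →
      lam (φ '' A) = ∫⁻ x in A, ENNReal.ofReal (volumeDensity φ x)

end Submanifold

/-! ### The data generating manifold -/

section DataGenerating

variable {m n q : ℕ}

/-- The Jacobian matrix of `f` at `x`. -/
def jacobian {a b : ℕ} (f : Eu a → Eu b) (x : Eu a) : Matrix (Fin b) (Fin a) ℝ :=
  Matrix.of fun i j => fderiv ℝ f x (EuclideanSpace.single j 1) i

/-- The `n × m` matrix `∇_u G (u, θ)`. -/
def gradU (G : Eu m → Eu q → Eu n) (u : Eu m) (θ : Eu q) : Matrix (Fin n) (Fin m) ℝ :=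
  jacobian (fun v => G v θ) u

/-- The `n × q` matrix `∇_θ G (u, θ)`. -/
def gradTheta (G : Eu m → Eu q → Eu n) (u : Eu m) (θ : Eu q) : Matrix (Fin n) (Fin q) ℝ :=
  jacobian (fun ϑ => G u ϑ) θ

/-- `θ` minimizes `ϑ ↦ ‖G (u, ϑ) - y‖` over `Θ`. -/
def IsMinimizer (Θ : Set (Eu q)) (G : Eu m → Eu q → Eu n) (y : Eu n) (u : Eu m) (θ : Eu q) : Prop :=
  θ ∈ Θ ∧ IsMinOn (fun ϑ => ‖G u ϑ - y‖) Θ θ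

/-- `θ̂ (y, u) = argmin_{ϑ ∈ Θ} ‖G (u, ϑ) - y‖`. -/
def thetaHat (Θ : Set (Eu q)) (G : Eu m → Eu q → Eu n) (y : Eu n) (u : Eu m) : Eu q :=
  Classical.epsilon (IsMinimizer Θ G y u)

/-- `𝒢(y) = {(u, θ) ∈ Υ × Θ : G (u, θ) = y}`. -/
def dataManifold (Υ : Set (Eu m)) (Θ : Set (Eu q)) (G : Eu m → Eu q → Eu n) (y : Eu n) :
    Set (EuProd m q) :=
  {p | p.fst ∈ Υ ∧ p.snd ∈ Θ ∧ G p.fst p.snd = y}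

/-- `𝒰(y) = {u ∈ Υ : min_{ϑ ∈ Θ} ‖G (u, ϑ) - y‖ = 0}`. -/
def uProjection (Υ : Set (Eu m)) (Θ : Set (Eu q)) (G : Eu m → Eu q → Eu n) (y : Eu n) :
    Set (Eu m) :=
  {u | u ∈ Υ ∧ IsLeast ((fun ϑ => ‖G u ϑ - y‖) '' Θ) 0}

/-- The columns of `B` are orthonormal and orthogonal to those of `A`; when `A` has full column rank
they form an orthonormal basis of the orthogonal complement of the column space of `A`. -/
def IsOrthonormalComplement (A : Matrix (Fin n) (Fin q) ℝ) (B : Matrix (Fin n) (Fin (n - q)) ℝ) :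
    Prop :=
  B.transpose * B = 1 ∧ A.transpose * B = 0

/-- `D (u, θ) = det (I_q + [∇_θ Gᵀ (∇_u G ∇_u Gᵀ)⁻¹ ∇_θ G]⁻¹)`. -/
def Dterm (G : Eu m → Eu q → Eu n) (u : Eu m) (θ : Eu q) : ℝ :=
  Matrix.det (1 + ((gradTheta G u θ).transpose *
    (gradU G u θ * (gradU G u θ).transpose)⁻¹ * gradTheta G u θ)⁻¹)

end DataGenerating

end

/-! Since ∇_u G has full row rank, G is a submersion on Υ × Θ, and 𝒢(y) is a regular level set
(`isEmbeddedSubmanifold_levelSet`). A zero of the residual is a minimizer, so uniqueness of the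
minimizer makes the projection to u injective on 𝒢(y), with the graph map of `thetaHat` as inverse.
A tangent vector (0, w) of 𝒢(y) satisfies ∇_θ G w = 0, hence vanishes by full column rank
(`immersesTangent_fst`). The projection is thus an injective immersion. Carrying the topology of
𝒢(y) over to 𝒰(y) makes 𝒰(y) an immersed submanifold diffeomorphic to 𝒢(y); that topology always
refines the subspace topology, and equals it exactly when the graph map is continuous.

For the equation of 𝒰(y): at a minimizer the first order condition makes the residual orthogonal to
the columns of ∇_θ G, so it vanishes once it is also orthogonal to a basis of their orthogonal
complement. Gram-Schmidt yields such bases depending smoothly on the point.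

For the measures: change of variables shows that the densities of two parametrizations agree on
overlaps, so countably many of them glue to a unique measure. The ratio of the densities of a
parametrization ψ of 𝒢(y) and of its projection is linear algebra (`det_gram_add`): the columns of
Dψ = (P₁, P₂) span the kernel of (∇_u G, ∇_θ G), which forces det(P₁ᵀP₁ + P₂ᵀP₂) = det(P₁ᵀP₁) · D.
-/

noncomputable section

/-! ### Transition maps -/

section Transition

variable {X F : Type*} [Nonempty X] {V' : Set X} {φ ψ : X → F}

/-- The transition map between two local parametrizations. -/
def transition (φ ψ : X → F) (V' : Set X) : X → X :=
  Function.invFunOn ψ V' ∘ φ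

theorem transition_mem {x : X} (hx : φ x ∈ ψ '' V') : transition φ ψ V' x ∈ V' :=
  Function.invFunOn_mem hx

theorem apply_transition {x : X} (hx : φ x ∈ ψ '' V') : ψ (transition φ ψ V' x) = φ x :=
  Function.invFunOn_eq hx

end Transition

/-! ### Immersed submanifolds and their Riemannian measures -/

section Submanifold

open Topology Filter

variable {F : Type*} [NormedAddCommGroup F] [InnerProductSpace ℝ F]
  {k : WithTop ℕ∞} {d : ℕ} {M : Set F}
  {t : TopologicalSpace M} {V V' : Set (Eu d)} {φ ψ : Eu d → F}

namespace IsLocalParam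

theorem empty (φ : Eu d → F) : IsLocalParam k d M t ∅ φ where
  isOpen := isOpen_empty
  mapsTo := mapsTo_empty _ _
  injOn := injOn_empty _
  contDiffOn := contDiffOn_empty
  immersion := by simp
  homeo W hW := by
    obtain rfl := subset_empty_iff.1 hW
    simp

theorem contDiffAt (hφ : IsLocalParam k d M t V φ) {x : Eu d} (hx : x ∈ V) :
    ContDiffAt ℝ k φ x :=
  hφ.contDiffOn.contDiffAt (hφ.isOpen.mem_nhds hx)

/-- Both parametrizations are homeomorphisms onto `t`-open parts of M, so openness passes through
`t`. The ambient topology would not do, as `t` may be strictly finer. -/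
theorem isOpen_inter_preimage_image (hφ : IsLocalParam k d M t V φ)
    (hψ : IsLocalParam k d M t V' ψ) {W : Set (Eu d)} (hW : W ⊆ V') (hWo : IsOpen W) :
    IsOpen (V ∩ φ ⁻¹' (ψ '' W)) := by
  refine (hφ.homeo _ inter_subset_left).2 ?_
  have h : (Subtype.val : M → F) ⁻¹' (φ '' (V ∩ φ ⁻¹' (ψ '' W))) =
      Subtype.val ⁻¹' (φ '' V) ∩ Subtype.val ⁻¹' (ψ '' W) := by
    rw [image_inter_preimage, preimage_inter]
  rw [h]
  exact IsOpen.inter ((hφ.homeo V subset_rfl).1 hφ.isOpen) ((hψ.homeo W hW).1 hWo)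

/-- Composing ψ with a linear left inverse L of its derivative at z gives a local diffeomorphism e
of ℝ^d, and near x the transition map is e⁻¹ ∘ L ∘ φ. -/
theorem contDiffOn_transition [FiniteDimensional ℝ F] (hk : k ≠ 0)
    (hφ : IsLocalParam k d M t V φ) (hψ : IsLocalParam k d M t V' ψ) :
    ContDiffOn ℝ k (transition φ ψ V') (V ∩ φ ⁻¹' (ψ '' V')) := by
  intro x hx
  apply ContDiffAt.contDiffWithinAt
  have hz : transition φ ψ V' x ∈ V' := transition_mem hx.2
  have hzx : ψ (transition φ ψ V' x) = φ x := apply_transition hx.2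
  set z := transition φ ψ V' x with hzdef
  obtain ⟨L, hL⟩ := LinearMap.exists_leftInverse_of_injective
    (fderiv ℝ ψ z : Eu d →ₗ[ℝ] F) (LinearMap.ker_eq_bot.2 (hψ.immersion z hz))
  let L' : F →L[ℝ] Eu d := L.toContinuousLinearMap
  have hc : ContDiffAt ℝ k (fun w => L' (ψ w)) z :=
    L'.contDiff.contDiffAt.comp z (hψ.contDiffAt hz)
  have hd : HasFDerivAt (fun w => L' (ψ w))
      ((ContinuousLinearEquiv.refl ℝ (Eu d) : Eu d ≃L[ℝ] Eu d) : Eu d →L[ℝ] Eu d) z := by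
    have h1 := L'.hasFDerivAt.comp z (((hψ.contDiffAt hz).differentiableAt hk).hasFDerivAt)
    convert! h1 using 1
    ext v : 1
    exact (LinearMap.congr_fun hL v).symm
  let e := hc.toOpenPartialHomeomorph _ hd hk
  have hze : z ∈ e.source := hc.mem_toOpenPartialHomeomorph_source hd hk
  -- Openness in `t` is what keeps the transition map inside `e.source` near x.
  have hO : IsOpen (V ∩ φ ⁻¹' (ψ '' (V' ∩ e.source))) :=
    hφ.isOpen_inter_preimage_image hψ inter_subset_left (hψ.isOpen.inter e.open_source)
  have hs : ContDiffAt ℝ k e.symm (L' (φ x)) := by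
    rw [← hzx]
    exact hc.to_localInverse hd hk
  have hcomp : ContDiffAt ℝ k (fun w => e.symm (L' (φ w))) x :=
    ContDiffAt.comp x hs (L'.contDiff.contDiffAt.comp x (hφ.contDiffAt hx.1))
  refine hcomp.congr_of_eventuallyEq ?_
  filter_upwards [hO.mem_nhds ⟨hx.1, z, ⟨hz, hze⟩, hzx⟩] with w hw
  obtain ⟨hwV, v, ⟨hvV, hve⟩, hvw⟩ := hw
  have h1 : φ w ∈ ψ '' V' := ⟨v, hvV, hvw⟩
  have h2 : transition φ ψ V' w = v :=
    hψ.injOn (transition_mem h1) hvV ((apply_transition h1).trans hvw.symm)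
  rw [h2, ← hvw]
  exact (e.left_inv hve).symm

end IsLocalParam

/-- The Gram determinant is multiplied by `det T ^ 2` under composition with `T`. -/
theorem det_gram_comp (A : Eu d →L[ℝ] F) (T : Eu d →L[ℝ] Eu d) :
    Matrix.det (Matrix.of fun i j : Fin d =>
      inner ℝ (A (T (EuclideanSpace.single i 1))) (A (T (EuclideanSpace.single j 1)))) =
    T.det ^ 2 * Matrix.det (Matrix.of fun i j : Fin d =>
      inner ℝ (A (EuclideanSpace.single i 1)) (A (EuclideanSpace.single j 1))) := by
  set N : Matrix (Fin d) (Fin d) ℝ := Matrix.of fun i j => T (EuclideanSpace.single j 1) i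
  have hN : T.det = N.det := by
    rw [ContinuousLinearMap.det,
      ← LinearMap.det_toMatrix (EuclideanSpace.basisFun (Fin d) ℝ).toBasis]
    rfl
  have hT : ∀ j, T (EuclideanSpace.single j 1) =
      ∑ l, N l j • EuclideanSpace.single l (1 : ℝ) := by
    intro j
    ext i
    simp [N, Finset.sum_apply, Pi.single_apply]
  have h : (Matrix.of fun i j : Fin d =>
      inner ℝ (A (T (EuclideanSpace.single i 1))) (A (T (EuclideanSpace.single j 1)))) =
      N.transpose * (Matrix.of fun i j : Fin d =>
        inner ℝ (A (EuclideanSpace.single i 1)) (A (EuclideanSpace.single j 1))) * N := by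
    ext i j
    simp only [Matrix.of_apply, hT, map_sum, map_smul, sum_inner, inner_sum, inner_smul_left,
      inner_smul_right, Matrix.mul_apply, Matrix.transpose_apply, Finset.sum_mul, Finset.mul_sum]
    refine Finset.sum_congr rfl fun a _ => Finset.sum_congr rfl fun b _ => ?_
    simp
    ring
  rw [h, Matrix.det_mul, Matrix.det_mul, Matrix.det_transpose, hN]
  ring

namespace IsLocalParam

/-- Chain rule for φ = ψ ∘ τ, with τ the transition map, followed by `det_gram_comp`. -/
theorem volumeDensity_eq_transition [FiniteDimensional ℝ F] (hk : k ≠ 0)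
    (hφ : IsLocalParam k d M t V φ) (hψ : IsLocalParam k d M t V' ψ) {x : Eu d} (hx : x ∈ V)
    (hx' : φ x ∈ ψ '' V') :
    volumeDensity φ x = |(fderiv ℝ (transition φ ψ V') x).det| *
      volumeDensity ψ (transition φ ψ V' x) := by
  have hO := hφ.isOpen_inter_preimage_image hψ subset_rfl hψ.isOpen
  have hτ := ((hφ.contDiffOn_transition hk hψ).contDiffAt
    (hO.mem_nhds ⟨hx, hx'⟩)).differentiableAt hk
  have hψd := (hψ.contDiffAt (transition_mem hx')).differentiableAt hk
  have hcomp : fderiv ℝ φ x = (fderiv ℝ ψ (transition φ ψ V' x)).comp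
      (fderiv ℝ (transition φ ψ V') x) := by
    rw [← fderiv_comp x hψd hτ]
    apply Filter.EventuallyEq.fderiv_eq
    filter_upwards [hO.mem_nhds ⟨hx, hx'⟩] with w hw
    exact (apply_transition hw.2).symm
  unfold volumeDensity
  simp only [hcomp, ContinuousLinearMap.comp_apply]
  rw [det_gram_comp, Real.sqrt_mul (sq_nonneg _), Real.sqrt_sq_eq_abs]

/-- Change of variables along the transition map, whose Jacobian is the ratio of the two densities.
This makes the Riemannian measure independent of the parametrization. -/
theorem setLIntegral_volumeDensity_eq [FiniteDimensional ℝ F] (hk : k ≠ 0)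
    (hφ : IsLocalParam k d M t V φ) (hψ : IsLocalParam k d M t V' ψ) {A C : Set (Eu d)}
    (hA : A ⊆ V) (hAm : MeasurableSet A) (hC : C ⊆ V') (h : φ '' A = ψ '' C) :
    ∫⁻ x in A, ENNReal.ofReal (volumeDensity φ x) =
      ∫⁻ x in C, ENNReal.ofReal (volumeDensity ψ x) := by
  have hmem : ∀ x ∈ A, φ x ∈ ψ '' V' := fun x hx =>
    image_mono hC (h ▸ mem_image_of_mem φ hx)
  have himg : transition φ ψ V' '' A = C := by
    ext z
    constructor
    · rintro ⟨x, hx, rfl⟩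
      obtain ⟨c, hc, hcx⟩ : φ x ∈ ψ '' C := h ▸ mem_image_of_mem φ hx
      rwa [hψ.injOn (transition_mem (hmem x hx)) (hC hc)
        ((apply_transition (hmem x hx)).trans hcx.symm)]
    · intro hz
      obtain ⟨x, hx, hxz⟩ : ψ z ∈ φ '' A := h ▸ mem_image_of_mem ψ hz
      exact ⟨x, hx, hψ.injOn (transition_mem (hmem x hx)) (hC hz)
        ((apply_transition (hmem x hx)).trans hxz)⟩
  have hinj : InjOn (transition φ ψ V') A := by
    intro x hx w hw hxw
    apply hφ.injOn (hA hx) (hA hw)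
    rw [← apply_transition (hmem x hx), ← apply_transition (hmem w hw), hxw]
  have hO := hφ.isOpen_inter_preimage_image hψ subset_rfl hψ.isOpen
  have hder : ∀ x ∈ A, HasFDerivWithinAt (transition φ ψ V')
      (fderiv ℝ (transition φ ψ V') x) A x := fun x hx =>
    (((hφ.contDiffOn_transition hk hψ).contDiffAt
      (hO.mem_nhds ⟨hA hx, hmem x hx⟩)).differentiableAt hk).hasFDerivAt.hasFDerivWithinAt
  rw [← himg, lintegral_image_eq_lintegral_abs_det_fderiv_mul volume hAm hder hinj]
  refine setLIntegral_congr_fun hAm fun x hx => ?_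
  rw [← ENNReal.ofReal_mul (abs_nonneg _),
    ← hφ.volumeDensity_eq_transition hk hψ (hA hx) (hmem x hx)]

section Measurable

variable [MeasurableSpace F] [BorelSpace F]

theorem measurableSet_image (hφ : IsLocalParam k d M t V φ) {A : Set (Eu d)}
    (hA : A ⊆ V) (hAm : MeasurableSet A) : MeasurableSet (φ '' A) :=
  hAm.image_of_continuousOn_injOn (hφ.contDiffOn.continuousOn.mono hA) (hφ.injOn.mono hA)

theorem measurableSet_inter_preimage (hφ : IsLocalParam k d M t V φ) {B : Set F}
    (hB : MeasurableSet B) : MeasurableSet (V ∩ φ ⁻¹' B) := by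
  have h : Measurable (V.domRestrict φ) := hφ.contDiffOn.continuousOn.domRestrict.measurable
  have := hφ.isOpen.measurableSet.subtype_image (h hB)
  rwa [domRestrict_eq, preimage_comp, Subtype.image_preimage_coe] at this

theorem aemeasurable (hφ : IsLocalParam k d M t V φ) : AEMeasurable φ (volume.restrict V) :=
  hφ.contDiffOn.continuousOn.aemeasurable hφ.isOpen.measurableSet

end Measurable

end IsLocalParam

/-- Second countability of `t` gives a countable subcover by parametrized pieces. -/
theorem IsSubmanifold.exists_seq (hM : IsSubmanifold k d M t) :
    ∃ (V : ℕ → Set (Eu d)) (φ : ℕ → Eu d → F),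
      (∀ i, IsLocalParam k d M t (V i) (φ i)) ∧ ⋃ i, φ i '' V i = M := by
  choose V φ hφ hp using fun p : M => hM.exists_param p p.2
  obtain ⟨T, hTc, hT⟩ := @TopologicalSpace.isOpen_iUnion_countable M t hM.secondCountable M
    (fun p => Subtype.val ⁻¹' (φ p '' V p)) (fun p => ((hφ p).homeo _ subset_rfl).1 (hφ p).isOpen)
  have hcov : ∀ p : M, ∃ i ∈ T, (p : F) ∈ φ i '' V i := by
    intro p
    have : p ∈ ⋃ i ∈ T, (Subtype.val : M → F) ⁻¹' (φ i '' V i) := by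
      rw [hT]
      exact mem_iUnion.2 ⟨p, hp p⟩
    simpa only [mem_iUnion, exists_prop, mem_preimage] using this
  rcases T.eq_empty_or_nonempty with rfl | hne
  -- An empty subcover cannot be enumerated by ℕ; M is then empty, and the empty parametrization is
  -- repeated.
  · refine ⟨fun _ => ∅, fun _ _ => 0, fun _ => .empty _, ?_⟩
    symm
    simp only [image_empty, iUnion_empty]
    refine eq_empty_of_forall_notMem fun p hpM => ?_
    obtain ⟨i, hi, -⟩ := hcov ⟨p, hpM⟩
    exact hi
  · obtain ⟨e, rfl⟩ := hTc.exists_eq_range hne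
    refine ⟨fun i => V (e i), fun i => φ (e i), fun i => hφ _, Subset.antisymm ?_ ?_⟩
    · exact iUnion_subset fun i => (hφ (e i)).mapsTo.image_subset
    · intro p hpM
      obtain ⟨_, ⟨i, rfl⟩, hi⟩ := hcov ⟨p, hpM⟩
      exact mem_iUnion.2 ⟨i, hi⟩

theorem IsLocalParam.continuousOn_volumeDensity (hk : k ≠ 0)
    (hφ : IsLocalParam k d M t V φ) :
    ContinuousOn (volumeDensity φ) V := by
  have h : ContinuousOn (fderiv ℝ φ) V := hφ.contDiffOn.continuousOn_fderiv_of_isOpen hφ.isOpen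
    (ENat.one_le_iff_ne_zero_withTop.2 hk)
  refine Real.continuous_sqrt.comp_continuousOn ?_
  have hdet : Continuous fun N : Matrix (Fin d) (Fin d) ℝ => N.det := continuous_id.matrix_det
  refine hdet.comp_continuousOn ?_
  refine continuousOn_pi.2 fun i => continuousOn_pi.2 fun j => ?_
  exact (h.clm_apply continuousOn_const).inner (h.clm_apply continuousOn_const)

section Measure

variable [MeasurableSpace F] [BorelSpace F]

theorem IsSubmanifold.exists_partition (hM : IsSubmanifold k d M t) :
    ∃ (V : ℕ → Set (Eu d)) (φ : ℕ → Eu d → F) (E : ℕ → Set F),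
      (∀ i, IsLocalParam k d M t (V i) (φ i)) ∧ (∀ i, MeasurableSet (E i)) ∧
      (∀ i, E i ⊆ φ i '' V i) ∧ Pairwise (Function.onFun Disjoint E) ∧ ⋃ i, E i = M := by
  obtain ⟨V, φ, hφ, hU⟩ := hM.exists_seq
  refine ⟨V, φ, disjointed fun i => φ i '' V i, hφ, ?_, fun i => disjointed_subset _ i,
    disjoint_disjointed _, by rw [iUnion_disjointed, hU]⟩
  exact fun i => .disjointed
    (fun j => (hφ j).measurableSet_image subset_rfl (hφ j).isOpen.measurableSet) i

theorem IsSubmanifold.measurableSet (hM : IsSubmanifold k d M t) : MeasurableSet M := by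
  obtain ⟨V, φ, E, -, hE, -, -, hU⟩ := hM.exists_partition
  rw [← hU]
  exact .iUnion hE

/-- On each piece of a countable partition the density measure of one parametrization is pushed
forward, and the results are summed. Any other parametrization is cut along the pieces and compared
on each by change of variables. -/
theorem IsSubmanifold.exists_isRiemannianMeasure [FiniteDimensional ℝ F] (hk : k ≠ 0)
    (hM : IsSubmanifold k d M t) : ∃ lam : Measure F, IsRiemannianMeasure k d M t lam := by
  obtain ⟨V, φ, E, hφ, hE, hEφ, hdisj, hU⟩ := hM.exists_partition
  have hP : ∀ i, MeasurableSet (V i ∩ φ i ⁻¹' E i) := fun i =>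
    (hφ i).measurableSet_inter_preimage (hE i)
  let lam : Measure F := Measure.sum fun i =>
    ((volume.restrict (V i ∩ φ i ⁻¹' E i)).withDensity
      fun x => ENNReal.ofReal (volumeDensity (φ i) x)).map (φ i)
  have hlam : ∀ B, MeasurableSet B → lam B = ∑' i,
      ∫⁻ x in V i ∩ φ i ⁻¹' (E i ∩ B), ENNReal.ofReal (volumeDensity (φ i) x) := by
    intro B hB
    rw [Measure.sum_apply _ hB]
    congr 1
    ext i
    have hae : AEMeasurable (φ i) ((volume.restrict (V i ∩ φ i ⁻¹' E i)).withDensity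
        fun x => ENNReal.ofReal (volumeDensity (φ i) x)) :=
      ((hφ i).aemeasurable.mono_measure (Measure.restrict_mono inter_subset_left le_rfl)).mono_ac
        (withDensity_absolutelyContinuous _ _)
    rw [Measure.map_apply_of_aemeasurable hae hB, withDensity_apply',
      Measure.restrict_restrict' (hP i), inter_comm, inter_assoc, preimage_inter]
  refine ⟨lam, ?_, ?_⟩
  · rw [hlam _ hM.measurableSet.compl]
    refine ENNReal.tsum_eq_zero.2 fun i => ?_
    have : E i ∩ Mᶜ = ∅ := by
      rw [← disjoint_iff_inter_eq_empty, disjoint_compl_right_iff_subset, ← hU]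
      exact subset_iUnion E i
    simp [this]
  · intro W ψ hψ A hA hAm
    rw [hlam _ (hψ.measurableSet_image hA hAm)]
    have hAi : ∀ i, MeasurableSet (A ∩ ψ ⁻¹' E i) := fun i => by
      have := hAm.inter (hψ.measurableSet_inter_preimage (hE i))
      rwa [← inter_assoc, inter_eq_left.2 hA] at this
    have hAU : A = ⋃ i, A ∩ ψ ⁻¹' E i := by
      rw [← inter_iUnion, ← preimage_iUnion, hU]
      exact (inter_eq_left.2 fun x hx => hψ.mapsTo (hA hx)).symm
    conv_rhs => rw [hAU]
    rw [lintegral_iUnion hAi]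
    · congr 1
      ext i
      symm
      refine hψ.setLIntegral_volumeDensity_eq hk (hφ i) (inter_subset_left.trans hA) (hAi i)
        inter_subset_left ?_
      rw [image_inter_preimage, image_inter_preimage, inter_comm (ψ '' A), ← inter_assoc,
        inter_eq_right.2 (hEφ i)]
    · intro i j hij
      exact ((hdisj hij).preimage ψ).mono inter_subset_right inter_subset_right

/-- Each piece of a countable partition lies in one parametrized patch, where the value is forced,
and the complement of M is null. -/
theorem IsRiemannianMeasure.eq (hM : IsSubmanifold k d M t) {lam lam' : Measure F}
    (h : IsRiemannianMeasure k d M t lam) (h' : IsRiemannianMeasure k d M t lam') :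
    lam = lam' := by
  obtain ⟨V, φ, E, hφ, hE, hEφ, hdisj, hU⟩ := hM.exists_partition
  have key : ∀ {l : Measure F}, IsRiemannianMeasure k d M t l → ∀ B, MeasurableSet B →
      l B = ∑' i, ∫⁻ x in V i ∩ φ i ⁻¹' (E i ∩ B), ENNReal.ofReal (volumeDensity (φ i) x) := by
    intro l hl B hB
    rw [← measure_inter_add_sdiff B hM.measurableSet,
      measure_mono_null (sdiff_subset_compl B M) hl.compl_eq_zero, add_zero, inter_comm, ← hU,
      iUnion_inter, measure_iUnion _ fun i => (hE i).inter hB]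
    · congr 1
      ext i
      rw [← hl.image_eq (V i) (φ i) (hφ i) _ inter_subset_left
        ((hφ i).measurableSet_inter_preimage ((hE i).inter hB)), image_inter_preimage,
        ← inter_assoc, inter_eq_right.2 (hEφ i)]
    · exact fun i j hij => (hdisj hij).mono inter_subset_left inter_subset_left
  ext B hB
  rw [key h B hB, key h' B hB]

theorem IsSubmanifold.existsUnique_isRiemannianMeasure [FiniteDimensional ℝ F] (hk : k ≠ 0)
    (hM : IsSubmanifold k d M t) : ∃! lam : Measure F, IsRiemannianMeasure k d M t lam := by
  obtain ⟨lam, hlam⟩ := hM.exists_isRiemannianMeasure hk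
  exact ⟨lam, hlam, fun l hl => hl.eq hM hlam⟩

theorem IsRiemannianMeasure.setLIntegral_image (hk : k ≠ 0) {lam : Measure F}
    (h : IsRiemannianMeasure k d M t lam) (hφ : IsLocalParam k d M t V φ) {A : Set (Eu d)}
    (hA : A ⊆ V) (hAm : MeasurableSet A) {f : F → ENNReal}
    (hf : AEMeasurable f (lam.restrict (φ '' A))) :
    ∫⁻ p in φ '' A, f p ∂lam =
      ∫⁻ x in A, ENNReal.ofReal (volumeDensity φ x) * f (φ x) := by
  set ν := (volume.restrict A).withDensity fun x => ENNReal.ofReal (volumeDensity φ x) with hν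
  have hae : AEMeasurable φ (volume.restrict A) :=
    hφ.aemeasurable.mono_measure (Measure.restrict_mono hA le_rfl)
  have hae' : AEMeasurable φ ν := hae.mono_ac (withDensity_absolutelyContinuous _ _)
  have hmap : lam.restrict (φ '' A) = ν.map φ := by
    ext B hB
    have hm : MeasurableSet (A ∩ φ ⁻¹' B) := by
      have := hAm.inter (hφ.measurableSet_inter_preimage hB)
      rwa [← inter_assoc, inter_eq_left.2 hA] at this
    rw [Measure.restrict_apply hB, Measure.map_apply_of_aemeasurable hae' hB, withDensity_apply',
      Measure.restrict_restrict' hAm, inter_comm B, ← image_inter_preimage,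
      h.image_eq V φ hφ _ (inter_subset_left.trans hA) hm, inter_comm]
  rw [hmap] at hf ⊢
  have hρ : AEMeasurable (fun x => ENNReal.ofReal (volumeDensity φ x)) (volume.restrict A) :=
    (((hφ.continuousOn_volumeDensity hk).mono hA).aemeasurable hAm).ennreal_ofReal
  rw [lintegral_map' hf hae', hν]
  exact lintegral_withDensity_eq_lintegral_mul₀' hρ (hf.comp_aemeasurable hae')

end Measure

end Submanifold

/-! ### Regular level sets -/

section LevelSet

open Topology Filter Module

variable {E : Type*} [NormedAddCommGroup E] [InnerProductSpace ℝ E] [FiniteDimensional ℝ E]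
  {k : WithTop ℕ∞} {n : ℕ}

/-- A surjective linear map onto `ℝ^n` can be completed to a linear isomorphism onto
`ℝ^n × ℝ^(dim E - n)`. -/
theorem exists_prod_eq_equiv (L : E →L[ℝ] Eu n) (hL : Function.Surjective L) :
    ∃ (κ : E →L[ℝ] Eu (finrank ℝ E - n)) (e : E ≃L[ℝ] Eu n × Eu (finrank ℝ E - n)),
      (e : E →L[ℝ] Eu n × Eu (finrank ℝ E - n)) = L.prod κ := by
  have hrn := LinearMap.finrank_range_add_finrank_ker (L : E →ₗ[ℝ] Eu n)
  rw [LinearMap.range_eq_top.2 hL, finrank_top, finrank_euclideanSpace_fin] at hrn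
  have hker : finrank ℝ (LinearMap.ker (L : E →ₗ[ℝ] Eu n)) =
      finrank ℝ (Eu (finrank ℝ E - n)) := by
    rw [finrank_euclideanSpace_fin]
    omega
  let ε := LinearEquiv.ofFinrankEq _ _ hker
  -- `π` is a linear projection onto the kernel of `L`; `κ` reads it in coordinates, so `κ` is
  -- injective on that kernel.
  obtain ⟨π, hπ⟩ := LinearMap.exists_leftInverse_of_injective
    (LinearMap.ker (L : E →ₗ[ℝ] Eu n)).subtype (Submodule.ker_subtype _)
  let κ : E →L[ℝ] Eu (finrank ℝ E - n) := (ε.toLinearMap ∘ₗ π).toContinuousLinearMap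
  have hinj : Function.Injective (L.prod κ : E →ₗ[ℝ] Eu n × Eu (finrank ℝ E - n)) := by
    rw [injective_iff_map_eq_zero]
    intro v hv
    have h1 : L v = 0 := congrArg Prod.fst hv
    have h2 : ε (π v) = 0 := congrArg Prod.snd hv
    have h3 : π v = ⟨v, h1⟩ :=
      LinearMap.congr_fun hπ (⟨v, h1⟩ : LinearMap.ker (L : E →ₗ[ℝ] Eu n))
    rw [h3, LinearEquiv.map_eq_zero_iff] at h2
    exact congrArg Subtype.val h2
  have hdim : finrank ℝ E = finrank ℝ (Eu n × Eu (finrank ℝ E - n)) := by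
    rw [finrank_prod, finrank_euclideanSpace_fin, finrank_euclideanSpace_fin]
    omega
  refine ⟨κ, (LinearEquiv.ofInjectiveOfFinrankEq _ hinj hdim).toContinuousLinearEquiv, ?_⟩
  ext1 v
  rfl

/-- The regular level sets of a `C^k` map are embedded `C^k` submanifolds. -/
theorem isEmbeddedSubmanifold_levelSet (hk : k ≠ 0) {O : Set E} (hO : IsOpen O) {f : E → Eu n}
    (hf : ContDiffOn ℝ k f O) (hsurj : ∀ p ∈ O, Function.Surjective (fderiv ℝ f p)) (y : Eu n) :
    IsEmbeddedSubmanifold k (finrank ℝ E - n) {p | p ∈ O ∧ f p = y} := by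
  refine ⟨inferInstance, fun p₀ hp₀ => ?_⟩
  obtain ⟨hp₀O, hp₀y⟩ := hp₀
  have hfat : ∀ p ∈ O, ContDiffAt ℝ k f p := fun p hp => hf.contDiffAt (hO.mem_nhds hp)
  obtain ⟨κ, L, hL⟩ := exists_prod_eq_equiv (fderiv ℝ f p₀) (hsurj p₀ hp₀O)
  -- `Φ` straightens the level set: locally it becomes the slice {y} × ℝ^(dim E - n), and the
  -- inverse of `Φ` on this slice is the parametrization.
  let Φ : E → Eu n × Eu (finrank ℝ E - n) := fun p => (f p, κ p)
  have hΦ : ∀ p ∈ O, ContDiffAt ℝ k Φ p := fun p hp =>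
    (hfat p hp).prodMk κ.contDiff.contDiffAt
  have hΦ' : ∀ p ∈ O, HasFDerivAt Φ ((fderiv ℝ f p).prod κ) p := fun p hp =>
    ((hfat p hp).differentiableAt hk).hasFDerivAt.prodMk κ.hasFDerivAt
  have hΦ₀ : HasFDerivAt Φ (L : E →L[ℝ] Eu n × Eu (finrank ℝ E - n)) p₀ := by
    rw [hL]
    exact hΦ' p₀ hp₀O
  have hcont : ContinuousAt (fun p => (fderiv ℝ f p).prod κ) p₀ := by
    have h1 : ContinuousAt (fderiv ℝ f) p₀ :=
      (hf.continuousOn_fderiv_of_isOpen hO (ENat.one_le_iff_ne_zero_withTop.2 hk)).continuousAt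
        (hO.mem_nhds hp₀O)
    have h2 : Continuous fun A : E →L[ℝ] Eu n => A.prod κ :=
      (ContinuousLinearMap.prodₗᵢ ℝ (E := E) (F := Eu n) (G := Eu (finrank ℝ E - n))
        (𝕜 := ℝ)).continuous.comp (continuous_id.prodMk continuous_const)
    exact h2.continuousAt.comp h1
  -- Isomorphisms form an open set. Invertibility of the derivative is needed near `p₀`, not only
  -- there, so that the inverse of `Φ` is `C^k` on its whole domain.
  have hinv : ∀ᶠ p in 𝓝 p₀, ∃ L' : E ≃L[ℝ] Eu n × Eu (finrank ℝ E - n),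
      (L' : E →L[ℝ] Eu n × Eu (finrank ℝ E - n)) = (fderiv ℝ f p).prod κ := by
    have := hcont.eventually (hL ▸ L.nhds)
    exact this
  obtain ⟨S, hS, hSo, hp₀S⟩ := mem_nhds_iff.1 (hinv.and (hO.mem_nhds hp₀O))
  let e := ((hΦ p₀ hp₀O).toOpenPartialHomeomorph Φ hΦ₀ hk).restrOpen S hSo
  have heΦ : ∀ p, e p = Φ p := fun _ => rfl
  have heS : e.source ⊆ S := inter_subset_right
  have hp₀e : p₀ ∈ e.source :=
    ⟨(hΦ p₀ hp₀O).mem_toOpenPartialHomeomorph_source hΦ₀ hk, hp₀S⟩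
  let φ : Eu (finrank ℝ E - n) → E := fun x => e.symm (y, x)
  let V : Set (Eu (finrank ℝ E - n)) := {x | (y, x) ∈ e.target}
  have hVo : IsOpen V := e.open_target.preimage (by fun_prop)
  have hφsrc : ∀ x ∈ V, φ x ∈ e.source := fun x hx => e.map_target hx
  have hΦφ : ∀ x ∈ V, Φ (φ x) = (y, x) := fun x hx => e.right_inv hx
  have hfφ : ∀ x ∈ V, f (φ x) = y := fun x hx => congrArg Prod.fst (hΦφ x hx)
  have hκφ : ∀ x ∈ V, κ (φ x) = x := fun x hx => congrArg Prod.snd (hΦφ x hx)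
  have hφκ : ∀ p ∈ e.source, f p = y → κ p ∈ V ∧ φ (κ p) = p := by
    intro p hp hpy
    have h1 : (y, κ p) = e p := by rw [heΦ, ← hpy]
    refine ⟨?_, ?_⟩
    · change (y, κ p) ∈ e.target
      rw [h1]
      exact e.map_source hp
    · change e.symm (y, κ p) = p
      rw [h1]
      exact e.left_inv hp
  have hφc : ∀ x ∈ V, ContDiffAt ℝ k φ x := by
    intro x hx
    obtain ⟨⟨L', hL'⟩, hxO⟩ := hS (heS (hφsrc x hx))
    have h1 : ContDiffAt ℝ k e.symm (y, x) :=
      e.contDiffAt_symm (f₀' := L') hx (by rw [hL']; exact hΦ' _ hxO) (hΦ _ hxO)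
    exact h1.comp x (contDiffAt_const.prodMk contDiffAt_id)
  have hinj : InjOn φ V := fun x hx w hw h => by rw [← hκφ x hx, ← hκφ w hw, h]
  have hmaps : MapsTo φ V {p | p ∈ O ∧ f p = y} := fun x hx =>
    ⟨(hS (heS (hφsrc x hx))).2, hfφ x hx⟩
  refine ⟨V, φ, ⟨hVo, hmaps, hinj, fun x hx => (hφc x hx).contDiffWithinAt, ?_, ?_⟩, ?_⟩
  · intro x hx
    have h1 : HasFDerivAt (fun w => κ (φ w)) (κ.comp (fderiv ℝ φ x)) x :=
      κ.hasFDerivAt.comp x ((hφc x hx).differentiableAt hk).hasFDerivAt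
    have h2 : HasFDerivAt (fun w => κ (φ w))
        (ContinuousLinearMap.id ℝ (Eu (finrank ℝ E - n))) x := by
      refine (hasFDerivAt_id x).congr_of_eventuallyEq ?_
      filter_upwards [hVo.mem_nhds hx] with w hw using hκφ w hw
    have h3 : Function.LeftInverse κ (fderiv ℝ φ x) := fun v =>
      DFunLike.congr_fun (h1.unique h2) v
    exact h3.injective
  · intro W hW
    constructor
    · intro hWo
      refine ⟨e.source ∩ κ ⁻¹' W, e.open_source.inter (hWo.preimage κ.continuous), ?_⟩
      ext ⟨p, hpO, hpy⟩
      simp only [mem_preimage, mem_inter_iff, mem_image]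
      constructor
      · rintro ⟨hps, hpW⟩
        exact ⟨κ p, hpW, (hφκ p hps hpy).2⟩
      · rintro ⟨x, hx, rfl⟩
        exact ⟨hφsrc x (hW hx), by rwa [hκφ x (hW hx)]⟩
    · rintro ⟨U, hU, hUW⟩
      have h1 : W = V ∩ φ ⁻¹' U := by
        ext x
        constructor
        · intro hx
          refine ⟨hW hx, ?_⟩
          have : (⟨φ x, hmaps (hW hx)⟩ : {p | p ∈ O ∧ f p = y}) ∈
              (Subtype.val ⁻¹' U : Set {p | p ∈ O ∧ f p = y}) := by
            rw [hUW]
            exact mem_image_of_mem φ hx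
          exact this
        · rintro ⟨hx, hxU⟩
          have : (⟨φ x, hmaps hx⟩ : {p | p ∈ O ∧ f p = y}) ∈
              (Subtype.val ⁻¹' (φ '' W) : Set {p | p ∈ O ∧ f p = y}) := by
            rw [← hUW]
            exact hxU
          obtain ⟨w, hw, hwx⟩ := this
          rwa [← hinj (hW hw) hx hwx]
      rw [h1]
      exact ContinuousOn.isOpen_inter_preimage
        (fun x hx => (hφc x hx).continuousAt.continuousWithinAt) hVo hU
  · obtain ⟨h1, h2⟩ := hφκ p₀ hp₀e hp₀y
    exact ⟨_, h1, h2⟩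

end LevelSet

/-! ### Gram determinants -/

section Linear

open Matrix

variable {ι κ o l : Type*} [Fintype κ]

theorem Matrix.mulVec_injective_of_rank_eq_card {A : Matrix ι κ ℝ}
    (h : A.rank = Fintype.card κ) : Function.Injective A.mulVec := by
  have hrn := LinearMap.finrank_range_add_finrank_ker A.mulVecLin
  rw [Module.finrank_fintype_fun_eq_card] at hrn
  have h0 : Module.finrank ℝ (LinearMap.ker A.mulVecLin) = 0 := by
    have : A.rank = Module.finrank ℝ (LinearMap.range A.mulVecLin) := rfl
    omega
  exact LinearMap.ker_eq_bot.1 (Submodule.finrank_eq_zero.1 h0)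

theorem Matrix.rank_eq_card_of_mulVec_injective {A : Matrix ι κ ℝ}
    (h : Function.Injective A.mulVec) : A.rank = Fintype.card κ := by
  have := LinearMap.finrank_range_of_inj (f := A.mulVecLin) h
  rwa [Module.finrank_fintype_fun_eq_card] at this

theorem Matrix.isUnit_det_of_rank_eq_card [DecidableEq κ] {A : Matrix κ κ ℝ}
    (h : A.rank = Fintype.card κ) : IsUnit A.det := by
  rw [← Matrix.isUnit_iff_isUnit_det]
  exact Matrix.mulVec_injective_iff_isUnit.1 (Matrix.mulVec_injective_of_rank_eq_card h)

variable [Fintype ι] [DecidableEq ι]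

theorem isUnit_det_mul_transpose {A : Matrix ι κ ℝ} (hA : A.rank = Fintype.card ι) :
    IsUnit (A * Aᵀ).det :=
  Matrix.isUnit_det_of_rank_eq_card (by rw [Matrix.rank_self_mul_transpose, hA])

theorem transpose_mul_inv_mul_eq {A : Matrix ι κ ℝ} (hA : A.rank = Fintype.card ι)
    (B : Matrix ι o ℝ) :
    Bᵀ * (A * Aᵀ)⁻¹ * B = (Aᵀ * (A * Aᵀ)⁻¹ * B)ᵀ * (Aᵀ * (A * Aᵀ)⁻¹ * B) := by
  have hu := isUnit_det_mul_transpose hA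
  have hs : ((A * Aᵀ)⁻¹)ᵀ = (A * Aᵀ)⁻¹ := by
    rw [Matrix.transpose_nonsing_inv, Matrix.transpose_mul, Matrix.transpose_transpose]
  rw [Matrix.transpose_mul, Matrix.transpose_mul, hs, Matrix.transpose_transpose]
  calc Bᵀ * (A * Aᵀ)⁻¹ * B = Bᵀ * ((A * Aᵀ)⁻¹ * (A * Aᵀ)) * ((A * Aᵀ)⁻¹ * B) := by
        rw [Matrix.nonsing_inv_mul _ hu]
        simp [Matrix.mul_assoc]
    _ = _ := by simp only [Matrix.mul_assoc]

variable [Fintype o] [DecidableEq o]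

/-- With Q = Aᵀ(AAᵀ)⁻¹B the matrix is QᵀQ, and AQ = B forces Q to have at least the rank of B. -/
theorem isUnit_det_transpose_mul_inv_mul {A : Matrix ι κ ℝ} (hA : A.rank = Fintype.card ι)
    {B : Matrix ι o ℝ} (hB : B.rank = Fintype.card o) :
    IsUnit (Bᵀ * (A * Aᵀ)⁻¹ * B).det := by
  have hu := isUnit_det_mul_transpose hA
  apply Matrix.isUnit_det_of_rank_eq_card
  rw [transpose_mul_inv_mul_eq hA, Matrix.rank_transpose_mul_self]
  have h : A * (Aᵀ * (A * Aᵀ)⁻¹ * B) = B := by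
    rw [← Matrix.mul_assoc, ← Matrix.mul_assoc, Matrix.mul_nonsing_inv _ hu, Matrix.one_mul]
  refine le_antisymm (Matrix.rank_le_card_width _) ?_
  calc Fintype.card o = (A * (Aᵀ * (A * Aᵀ)⁻¹ * B)).rank := by rw [h, hB]
    _ ≤ _ := Matrix.rank_mul_le_right _ _

/-- If the columns of `(P₁, P₂)` span the kernel of `(A, B)`, then the Gram determinants of
`(P₁, P₂)` and of `P₁` differ by the factor `det (1 + (Bᵀ (A Aᵀ)⁻¹ B)⁻¹)`. -/
theorem det_gram_add [Fintype l] [DecidableEq l] {A : Matrix ι κ ℝ} (hA : A.rank = Fintype.card ι)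
    {B : Matrix ι o ℝ} (hB : B.rank = Fintype.card o) {P₁ : Matrix κ l ℝ} {P₂ : Matrix o l ℝ}
    (hP : A * P₁ + B * P₂ = 0) (hP₁ : Function.Injective P₁.mulVec)
    (hker : ∀ v w, A *ᵥ v + B *ᵥ w = 0 → ∃ r, P₁ *ᵥ r = v ∧ P₂ *ᵥ r = w) :
    (P₁ᵀ * P₁ + P₂ᵀ * P₂).det =
      (P₁ᵀ * P₁).det * (1 + (Bᵀ * (A * Aᵀ)⁻¹ * B)⁻¹).det := by
  have hu := isUnit_det_mul_transpose hA
  have hKu := isUnit_det_transpose_mul_inv_mul hA hB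
  have hKQ := transpose_mul_inv_mul_eq hA B
  set Q := Aᵀ * (A * Aᵀ)⁻¹ * B with hQ
  set K := Bᵀ * (A * Aᵀ)⁻¹ * B with hK
  have hSu : IsUnit (P₁ᵀ * P₁).det := by
    apply Matrix.isUnit_det_of_rank_eq_card
    rw [Matrix.rank_transpose_mul_self, Matrix.rank_eq_card_of_mulVec_injective hP₁]
  set S := P₁ᵀ * P₁ with hS
  have hAQ : A * Q = B := by
    rw [hQ, ← Matrix.mul_assoc, ← Matrix.mul_assoc, Matrix.mul_nonsing_inv _ hu, Matrix.one_mul]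
  have hKs : Kᵀ = K := by rw [hKQ]; simp
  have hKis : (K⁻¹)ᵀ = K⁻¹ := by rw [Matrix.transpose_nonsing_inv, hKs]
  have hQP : Qᵀ * P₁ = -(K * P₂) := by
    have h1 : A * P₁ = -(B * P₂) := eq_neg_of_add_eq_zero_left hP
    have hs : ((A * Aᵀ)⁻¹)ᵀ = (A * Aᵀ)⁻¹ := by
      rw [Matrix.transpose_nonsing_inv, Matrix.transpose_mul, Matrix.transpose_transpose]
    rw [hQ, Matrix.transpose_mul, Matrix.transpose_mul, hs, Matrix.transpose_transpose, hK]
    simp only [Matrix.mul_assoc, h1, Matrix.mul_neg]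
  have hP₂ : P₂ = -(K⁻¹ * (Qᵀ * P₁)) := by
    rw [hQP, Matrix.mul_neg, neg_neg, ← Matrix.mul_assoc, Matrix.nonsing_inv_mul _ hKu,
      Matrix.one_mul]
  -- As AQ = B, each pair (Q eⱼ, -eⱼ) lies in the kernel of (A, B); hence the columns of Q lie in
  -- the range of P₁.
  obtain ⟨R, hR⟩ : ∃ R : Matrix l o ℝ, P₁ * R = Q := by
    have h : ∀ j : o, ∃ r, P₁ *ᵥ r = Q.col j ∧ P₂ *ᵥ r = -Pi.single j 1 := by
      intro j
      apply hker
      have hQc : Q.col j = Q *ᵥ Pi.single j 1 := by simp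
      rw [hQc, Matrix.mulVec_mulVec, hAQ, Matrix.mulVec_neg, add_neg_cancel]
    choose r hr using h
    refine ⟨Matrix.of fun i j => r j i, ?_⟩
    ext i j
    exact congrFun (hr j).1 i
  -- P₁ S⁻¹ P₁ᵀ is the orthogonal projection onto the range of P₁.
  have hproj : P₁ * (S⁻¹ * (P₁ᵀ * Q)) = Q := by
    rw [← hR, ← Matrix.mul_assoc P₁ᵀ, ← hS, ← Matrix.mul_assoc S⁻¹,
      Matrix.nonsing_inv_mul _ hSu, Matrix.one_mul]
  have hP₂S : P₂ * (S⁻¹ * P₂ᵀ) = K⁻¹ := by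
    have hP₂t : P₂ᵀ = -((P₁ᵀ * Q) * K⁻¹) := by
      conv_lhs => rw [hP₂]
      rw [Matrix.transpose_neg, Matrix.transpose_mul, Matrix.transpose_mul, hKis,
        Matrix.transpose_transpose]
    rw [hP₂t]
    conv_lhs => rw [hP₂]
    rw [Matrix.mul_neg, Matrix.neg_mul, Matrix.mul_neg, neg_neg]
    calc K⁻¹ * (Qᵀ * P₁) * (S⁻¹ * (P₁ᵀ * Q * K⁻¹))
        = K⁻¹ * (Qᵀ * (P₁ * (S⁻¹ * (P₁ᵀ * Q)))) * K⁻¹ := by simp only [Matrix.mul_assoc]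
      _ = K⁻¹ := by
        rw [hproj, ← hKQ, Matrix.nonsing_inv_mul _ hKu, Matrix.one_mul]
  calc (S + P₂ᵀ * P₂).det = (S * (1 + (S⁻¹ * P₂ᵀ) * P₂)).det := by
        rw [Matrix.mul_add, Matrix.mul_one, ← Matrix.mul_assoc, ← Matrix.mul_assoc,
          Matrix.mul_nonsing_inv _ hSu, Matrix.one_mul]
    -- Sylvester's identity det(1 + XY) = det(1 + YX) trades the size of P₁ᵀP₁ for that of K.
    _ = S.det * (1 + K⁻¹).det := by
        rw [Matrix.det_mul, Matrix.det_one_add_mul_comm, hP₂S]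

/-- The inverted matrix is a Gram matrix, so its inverse is positive semidefinite, and adding the
identity makes it positive definite. -/
theorem det_one_add_inv_pos {A : Matrix ι κ ℝ} (hA : A.rank = Fintype.card ι)
    (B : Matrix ι o ℝ) :
    0 < (1 + (Bᵀ * (A * Aᵀ)⁻¹ * B)⁻¹).det := by
  have hpos : (1 + (Bᵀ * (A * Aᵀ)⁻¹ * B)⁻¹).PosDef := by
    refine Matrix.PosDef.one.add_posSemidef (Matrix.PosSemidef.inv ?_)
    rw [transpose_mul_inv_mul_eq hA]
    have := Matrix.posSemidef_conjTranspose_mul_self (Aᵀ * (A * Aᵀ)⁻¹ * B)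
    rwa [Matrix.conjTranspose_eq_transpose_of_trivial] at this
  exact hpos.det_pos

end Linear

/-! ### Smooth orthonormal complements -/

section Complement

open Topology Filter InnerProductSpace ContDiff

variable {X E ι : Type*} [NormedAddCommGroup X] [NormedSpace ℝ X] [NormedAddCommGroup E]
  [InnerProductSpace ℝ E] [LinearOrder ι] [LocallyFiniteOrderBot ι] [WellFoundedLT ι]

/-- The Gram-Schmidt process depends smoothly on the initial vectors. -/
theorem contDiffAt_gramSchmidt {k : WithTop ℕ∞} {f : X → ι → E} {x : X}
    (hf : ∀ i, ContDiffAt ℝ k (fun z => f z i) x) (hx : ∀ i, gramSchmidt ℝ (f x) i ≠ 0) (i : ι) :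
    ContDiffAt ℝ k (fun z => gramSchmidt ℝ (f z) i) x := by
  induction i using WellFoundedLT.induction with
  | ind i ih =>
    have h : (fun z => gramSchmidt ℝ (f z) i) = fun z => f z i - ∑ j ∈ Finset.Iio i,
        (inner ℝ (gramSchmidt ℝ (f z) j) (f z i) / ‖gramSchmidt ℝ (f z) j‖ ^ 2) •
          gramSchmidt ℝ (f z) j := by
      ext z
      exact eq_sub_of_add_eq (gramSchmidt_def'' ℝ (f z) i).symm
    rw [h]
    refine (hf i).sub (ContDiffAt.sum fun j hj => ?_)
    have hj' := ih j (Finset.mem_Iio.1 hj)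
    refine ContDiffAt.smul (ContDiffAt.div (hj'.inner ℝ (hf i)) (hj'.norm_sq ℝ) ?_) hj'
    exact pow_ne_zero 2 (norm_ne_zero_iff.2 (hx j))

variable {n q : ℕ}

theorem inner_toLp_col (A : Matrix (Fin n) (Fin q) ℝ) (v : Eu n) (j : Fin q) :
    inner ℝ (WithLp.toLp 2 (A.col j) : Eu n) v = (A.transpose.mulVec v.ofLp) j := by
  simp [PiLp.inner_apply, Matrix.mulVec, dotProduct, mul_comm]

theorem isOrthonormalComplement_of {A : Matrix (Fin n) (Fin q) ℝ} {b : Fin (n - q) → Eu n}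
    (hb : Orthonormal ℝ b)
    (hA : ∀ i j, inner ℝ (WithLp.toLp 2 (A.col i) : Eu n) (b j) = 0) :
    IsOrthonormalComplement A (Matrix.of fun i j => b j i) := by
  constructor
  · ext i j
    have := orthonormal_iff_ite.1 hb i j
    rw [Matrix.one_apply, ← this]
    simp [PiLp.inner_apply, Matrix.mul_apply, mul_comm]
  · ext i j
    rw [Matrix.zero_apply, ← hA i j]
    simp [PiLp.inner_apply, Matrix.mul_apply, mul_comm]

theorem linearIndependent_toLp_col {A : Matrix (Fin n) (Fin q) ℝ} (hA : A.rank = q) :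
    LinearIndependent ℝ fun j => (WithLp.toLp 2 (A.col j) : Eu n) := by
  have h : LinearIndependent ℝ A.col := by
    rw [← Matrix.mulVec_injective_iff]
    exact Matrix.mulVec_injective_of_rank_eq_card (by simpa using hA)
  exact h.map' ((WithLp.linearEquiv 2 ℝ (Fin n → ℝ)).symm : (Fin n → ℝ) →ₗ[ℝ] Eu n)
    (LinearEquiv.ker _)

theorem exists_orthonormal_compl {A : Matrix (Fin n) (Fin q) ℝ} (hA : A.rank = q) :
    ∃ b : Fin (n - q) → Eu n, Orthonormal ℝ b ∧
      ∀ i j, inner ℝ (WithLp.toLp 2 (A.col i) : Eu n) (b j) = 0 := by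
  set W := Submodule.span ℝ (range fun j => (WithLp.toLp 2 (A.col j) : Eu n)) with hW
  have hWd : Module.finrank ℝ W = q := by
    rw [hW, finrank_span_eq_card (linearIndependent_toLp_col hA), Fintype.card_fin]
  have hd : Module.finrank ℝ Wᗮ = n - q := by
    have := W.finrank_add_finrank_orthogonal
    rw [finrank_euclideanSpace_fin] at this
    omega
  let b := (stdOrthonormalBasis ℝ Wᗮ).reindex (finCongr hd)
  refine ⟨fun j => b j, b.orthonormal.comp_linearIsometry Wᗮ.subtypeₗᵢ, fun i j => ?_⟩
  exact Submodule.inner_right_of_mem_orthogonal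
    (Submodule.subset_span (mem_range_self i)) (b j).2

/-- A matrix function of full column rank that is `C^k` at a point has, in a neighbourhood of that
point, a `C^k` orthonormal complement. -/
theorem exists_contDiffOn_orthonormal_compl {k : WithTop ℕ∞} (hk : k ≠ ∞)
    {A : X → Matrix (Fin n) (Fin q) ℝ} {x : X}
    (hA : ∀ j, ContDiffAt ℝ k (fun z => (WithLp.toLp 2 ((A z).col j) : Eu n)) x)
    (hr : (A x).rank = q) :
    ∃ (O : Set X) (N : X → Matrix (Fin n) (Fin (n - q)) ℝ), IsOpen O ∧ x ∈ O ∧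
      (∀ z ∈ O, IsOrthonormalComplement (A z) (N z)) ∧
      ∀ i j, ContDiffOn ℝ k (fun z => N z i j) O := by
  obtain ⟨b, hb, hAb⟩ := exists_orthonormal_compl hr
  -- The columns of `A z` are completed by vectors frozen at the base point. Gram-Schmidt then makes
  -- the last n - q vectors orthogonal to the first q, which are the columns of `A z`.
  let f : X → Fin (q + (n - q)) → Eu n := fun z =>
    Fin.addCases (fun j => WithLp.toLp 2 ((A z).col j)) b
  have hfl : ∀ z j, f z (Fin.castAdd _ j) = WithLp.toLp 2 ((A z).col j) := fun z j => by
    simp [f]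
  have hfr : ∀ z j, f z (Fin.natAdd _ j) = b j := fun z j => by simp [f]
  have hf : ∀ i, ContDiffAt ℝ k (fun z => f z i) x := by
    intro i
    refine Fin.addCases (fun j => ?_) (fun j => ?_) i
    · simpa only [hfl] using hA j
    · simpa only [hfr] using contDiffAt_const
  have hli : LinearIndependent ℝ (f x) := by
    have h1 : LinearIndependent ℝ
        (Sum.elim (fun j => (WithLp.toLp 2 ((A x).col j) : Eu n)) b) := by
      refine (linearIndependent_toLp_col hr).sum_type hb.linearIndependent ?_
      refine Submodule.IsOrtho.disjoint ?_
      rw [Submodule.isOrtho_span]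
      rintro _ ⟨i, rfl⟩ _ ⟨j, rfl⟩
      exact hAb i j
    have h2 := h1.comp finSumFinEquiv.symm finSumFinEquiv.symm.injective
    convert! h2 using 1
    ext1 i
    refine Fin.addCases (fun j => ?_) (fun j => ?_) i
    · simp [hfl]
    · simp [hfr]
  have hgs := contDiffAt_gramSchmidt hf fun i => gramSchmidt_ne_zero i hli
  have hgn : ∀ i, ContDiffAt ℝ k (fun z => gramSchmidtNormed ℝ (f z) i) x := fun i =>
    (((hgs i).norm ℝ (gramSchmidt_ne_zero i hli)).inv
      (norm_ne_zero_iff.2 (gramSchmidt_ne_zero i hli))).smul (hgs i)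
  -- `k ≠ ∞` lets `C^k` at a point spread to a neighbourhood of it.
  have hev : ∀ᶠ z in 𝓝 x, ∀ i, gramSchmidt ℝ (f z) i ≠ 0 ∧
      ContDiffAt ℝ k (fun z => gramSchmidtNormed ℝ (f z) i) z :=
    eventually_all.2 fun i =>
      ((hgs i).continuousAt.eventually_ne (gramSchmidt_ne_zero i hli)).and ((hgn i).eventually hk)
  obtain ⟨O, hO, hOo, hxO⟩ := mem_nhds_iff.1 hev
  refine ⟨O, fun z => Matrix.of fun i j => gramSchmidtNormed ℝ (f z) (Fin.natAdd q j) i, hOo, hxO,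
    fun z hz => isOrthonormalComplement_of ⟨fun j => ?_, fun i j hij => ?_⟩ fun i j => ?_,
    fun i j z hz => ?_⟩
  · have := (hO hz (Fin.natAdd q j)).1
    simp only [gramSchmidtNormed]
    exact norm_smul_inv_norm this
  · simp only [gramSchmidtNormed, inner_smul_left, inner_smul_right]
    rw [gramSchmidt_orthogonal ℝ (f z) ((Fin.natAdd_injective (n - q) q).ne hij)]
    simp
  · rw [real_inner_comm, gramSchmidtNormed, inner_smul_left, ← hfl z i,
      gramSchmidt_inv_triangular ℝ (f z), mul_zero]
    simp [Fin.lt_def]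
    omega
  · have h1 := (hO hz (Fin.natAdd q j)).2
    have h2 : ContDiffAt ℝ k (fun v => gramSchmidtNormed ℝ (f v) (Fin.natAdd q j) i) z :=
      (EuclideanSpace.proj (𝕜 := ℝ) i : Eu n →L[ℝ] ℝ).contDiff.contDiffAt.comp z h1
    exact h2.contDiffWithinAt

end Complement

/-! ### Transport of a submanifold along an injective immersion -/

section Transport

open Topology Filter

variable {F F' : Type*} [NormedAddCommGroup F] [InnerProductSpace ℝ F]
  [NormedAddCommGroup F'] [InnerProductSpace ℝ F'] {k : WithTop ℕ∞} {d : ℕ} {M : Set F}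
  {N : Set F'} {f : F →L[ℝ] F'} {g : F' → F}

/-- The topology of `M` transported to a set `N` that `g` maps bijectively onto `M`. -/
abbrev transportedTopology (N : Set F') (g : F' → F) : TopologicalSpace N :=
  TopologicalSpace.induced (fun u : N => g u) inferInstance

theorem isOpen_transported_iff (hinv : InvOn g f M N) (hf : MapsTo f M N) (hg : MapsTo g N M)
    {C : Set F} (hC : C ⊆ M) :
    @IsOpen M (subspaceTopology M) (Subtype.val ⁻¹' C) ↔
      @IsOpen N (transportedTopology N g) (Subtype.val ⁻¹' (f '' C)) := by
  have hiff : ∀ u ∈ N, u ∈ f '' C ↔ g u ∈ C := by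
    intro u hu
    constructor
    · rintro ⟨p, hp, rfl⟩
      rwa [hinv.1 (hC hp)]
    · exact fun h => ⟨g u, h, hinv.2 hu⟩
  constructor
  · rintro ⟨O, hO, hOC⟩
    refine ⟨O, hO, ?_⟩
    ext ⟨u, hu⟩
    have := Set.ext_iff.1 hOC ⟨g u, hg hu⟩
    simp only [mem_preimage] at this ⊢
    rw [this, hiff u hu]
  · rintro ⟨O, hO, hOC⟩
    refine ⟨O, hO, ?_⟩
    ext ⟨p, hp⟩
    have := Set.ext_iff.1 hOC ⟨f p, hf hp⟩
    simp only [mem_preimage] at this ⊢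
    rw [hiff _ (hf hp), hinv.1 hp] at this
    exact this

/-- The inclusion of N is f ∘ g, so the transported topology always refines the subspace topology;
the reverse comparison is exactly continuity of g. -/
theorem transportedTopology_eq_subspace_iff (hinv : InvOn g f M N) :
    transportedTopology N g = subspaceTopology N ↔ ContinuousOn g N := by
  have hle : transportedTopology N g ≤ subspaceTopology N := by
    refine continuous_iff_le_induced.1 ?_
    have h1 : (Subtype.val : N → F') = f ∘ fun u : N => g u := by
      ext1 u
      exact (hinv.2 u.2).symm
    rw [h1]
    exact @Continuous.comp N F F' (transportedTopology N g) _ _ _ _ f.continuous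
      continuous_induced_dom
  rw [continuousOn_iff_continuous_domRestrict]
  constructor
  · intro h
    exact continuous_iff_le_induced.2 h.ge
  · intro h
    exact le_antisymm hle (continuous_iff_le_induced.1 h)

/-- `f` restricts to an immersion of the embedded submanifold `M`. -/
def ImmersesTangent (k : WithTop ℕ∞) (d : ℕ) (M : Set F) (f : F →L[ℝ] F') : Prop :=
  ∀ (V : Set (Eu d)) (ψ : Eu d → F), IsLocalParam k d M (subspaceTopology M) V ψ →
    ∀ x ∈ V, ∀ v, f (fderiv ℝ ψ x v) = 0 → v = 0

theorem IsLocalParam.image (hk : k ≠ 0) (himm : ImmersesTangent k d M f) (hinv : InvOn g f M N)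
    (hf : MapsTo f M N) (hg : MapsTo g N M) {V : Set (Eu d)} {ψ : Eu d → F}
    (hψ : IsLocalParam k d M (subspaceTopology M) V ψ) :
    IsLocalParam k d N (transportedTopology N g) V (f ∘ ψ) where
  isOpen := hψ.isOpen
  mapsTo := hf.comp hψ.mapsTo
  injOn := hinv.1.injOn.comp hψ.injOn hψ.mapsTo
  contDiffOn := f.contDiff.comp_contDiffOn hψ.contDiffOn
  immersion x hx := by
    rw [injective_iff_map_eq_zero]
    intro v hv
    rw [fderiv_comp x f.differentiableAt ((hψ.contDiffAt hx).differentiableAt hk), f.fderiv] at hv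
    exact himm V ψ hψ x hx v hv
  homeo W hW := by
    rw [hψ.homeo W hW, image_comp]
    exact isOpen_transported_iff hinv hf hg ((image_mono hW).trans hψ.mapsTo.image_subset)

theorem isSubmanifold_transported (hk : k ≠ 0) (himm : ImmersesTangent k d M f)
    (hinv : InvOn g f M N) (hf : MapsTo f M N) (hg : MapsTo g N M)
    [SecondCountableTopology F] (hM : IsEmbeddedSubmanifold k d M) :
    IsSubmanifold k d N (transportedTopology N g) where
  secondCountable := TopologicalSpace.secondCountableTopology_induced _ _ _
  exists_param u hu := by
    obtain ⟨V, ψ, hψ, x, hx, hxu⟩ := hM.exists_param (g u) (hg hu)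
    refine ⟨V, f ∘ ψ, hψ.image hk himm hinv hf hg, x, hx, ?_⟩
    rw [Function.comp_apply, hxu, hinv.2 hu]

/-- Locally g ∘ φ = ψ ∘ τ, where ψ parametrizes M and τ is the transition map from φ to f ∘ ψ. No
smoothness of g on the ambient space is needed. -/
theorem IsLocalParam.contDiffOn_lift [FiniteDimensional ℝ F'] (hk : k ≠ 0)
    (himm : ImmersesTangent k d M f) (hinv : InvOn g f M N) (hf : MapsTo f M N)
    (hg : MapsTo g N M) (hM : IsEmbeddedSubmanifold k d M) {V : Set (Eu d)} {φ : Eu d → F'}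
    (hφ : IsLocalParam k d N (transportedTopology N g) V φ) : ContDiffOn ℝ k (g ∘ φ) V := by
  intro x hx
  obtain ⟨V', ψ, hψ, z, hz, hzx⟩ := hM.exists_param (g (φ x)) (hg (hφ.mapsTo hx))
  have hψ' := hψ.image hk himm hinv hf hg
  have hxmem : φ x ∈ (f ∘ ψ) '' V' :=
    ⟨z, hz, by rw [Function.comp_apply, hzx, hinv.2 (hφ.mapsTo hx)]⟩
  have hO := hφ.isOpen_inter_preimage_image hψ' subset_rfl hψ'.isOpen
  have hτ := (hφ.contDiffOn_transition hk hψ').contDiffAt (hO.mem_nhds ⟨hx, hxmem⟩)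
  have hcomp := (hψ.contDiffAt (transition_mem hxmem)).comp x hτ
  refine (hcomp.congr_of_eventuallyEq ?_).contDiffWithinAt
  filter_upwards [hO.mem_nhds ⟨hx, hxmem⟩] with w hw
  have h1 := apply_transition hw.2
  rw [Function.comp_apply, Function.comp_apply, ← h1, Function.comp_apply,
    hinv.1 (hψ.mapsTo (transition_mem hw.2))]

/-- Every parametrization of N thus comes from one of M, so densities need comparing only for
parametrizations of the form f ∘ ψ. -/
theorem IsLocalParam.lift [FiniteDimensional ℝ F'] (hk : k ≠ 0)
    (himm : ImmersesTangent k d M f) (hinv : InvOn g f M N) (hf : MapsTo f M N)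
    (hg : MapsTo g N M) (hM : IsEmbeddedSubmanifold k d M) {V : Set (Eu d)} {φ : Eu d → F'}
    (hφ : IsLocalParam k d N (transportedTopology N g) V φ) :
    IsLocalParam k d M (subspaceTopology M) V (g ∘ φ) := by
  have hc := hφ.contDiffOn_lift hk himm hinv hf hg hM
  have hfg : ∀ x ∈ V, f (g (φ x)) = φ x := fun x hx => hinv.2 (hφ.mapsTo hx)
  refine ⟨hφ.isOpen, hg.comp hφ.mapsTo, hinv.2.injOn.comp hφ.injOn hφ.mapsTo, hc, ?_, ?_⟩
  · intro x hx
    have hd := (hc.contDiffAt (hφ.isOpen.mem_nhds hx)).differentiableAt hk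
    have h1 : fderiv ℝ φ x = f.comp (fderiv ℝ (g ∘ φ) x) := by
      rw [← f.fderiv (x := (g ∘ φ) x), ← fderiv_comp x f.differentiableAt hd]
      apply Filter.EventuallyEq.fderiv_eq
      filter_upwards [hφ.isOpen.mem_nhds hx] with w hw using (hfg w hw).symm
    have h2 := hφ.immersion x hx
    rw [h1, ContinuousLinearMap.coe_comp] at h2
    exact h2.of_comp
  · intro W hW
    have hWM : (g ∘ φ) '' W ⊆ M := (image_mono hW).trans (hg.comp hφ.mapsTo).image_subset
    rw [hφ.homeo W hW, isOpen_transported_iff hinv hf hg hWM, ← image_comp]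
    have : (f ∘ g ∘ φ) '' W = φ '' W := image_congr fun x hx => hfg x (hW hx)
    rw [this]

theorem isCkDiffeo_transported [FiniteDimensional ℝ F'] (hk : k ≠ 0)
    (himm : ImmersesTangent k d M f) (hinv : InvOn g f M N) (hf : MapsTo f M N)
    (hg : MapsTo g N M) (hM : IsEmbeddedSubmanifold k d M) :
    IsCkDiffeo k d M (subspaceTopology M) N (transportedTopology N g) f g where
  toFun := by
    refine ⟨⟨hf, continuous_induced_rng.2 ?_⟩, fun V φ hφ =>
      f.contDiff.comp_contDiffOn hφ.contDiffOn⟩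
    have : (fun u : N => g u) ∘ hf.restrict f M N = Subtype.val := by
      ext1 p
      exact hinv.1 p.2
    rw [this]
    exact continuous_subtype_val
  invFun := by
    refine ⟨⟨hg, ?_⟩, fun V φ hφ => hφ.contDiffOn_lift hk himm hinv hf hg hM⟩
    refine continuous_induced_rng.2 ?_
    exact continuous_induced_dom
  invOn := hinv

/-- The Riemannian measure of the image is the image of the Riemannian measure, weighted by the
ratio of the volume densities. -/
theorem IsRiemannianMeasure.apply_transported [FiniteDimensional ℝ F] [FiniteDimensional ℝ F']
    [MeasurableSpace F] [BorelSpace F] [MeasurableSpace F'] [BorelSpace F'] (hk : k ≠ 0)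
    (himm : ImmersesTangent k d M f) (hinv : InvOn g f M N) (hf : MapsTo f M N)
    (hg : MapsTo g N M) (hM : IsEmbeddedSubmanifold k d M) {h : F → ENNReal} {lam : Measure F}
    {lam' : Measure F'} (hlam : IsRiemannianMeasure k d M (subspaceTopology M) lam)
    (hlam' : IsRiemannianMeasure k d N (transportedTopology N g) lam')
    (hh : AEMeasurable h (lam.restrict M))
    (hD : ∀ (V : Set (Eu d)) (ψ : Eu d → F), IsLocalParam k d M (subspaceTopology M) V ψ →
      ∀ x ∈ V, ENNReal.ofReal (volumeDensity (f ∘ ψ) x) =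
        ENNReal.ofReal (volumeDensity ψ x) * h (ψ x))
    {B : Set F'} (hB : MeasurableSet B) :
    lam' B = ∫⁻ p in {p ∈ M | f p ∈ B}, h p ∂lam := by
  have hN := isSubmanifold_transported hk himm hinv hf hg hM
  have hMm : MeasurableSet M := hM.measurableSet
  have hfm : Measurable f := f.continuous.measurable
  set ν := ((lam.restrict M).withDensity h).map f with hν
  have hνB : ∀ B, MeasurableSet B → ν B = ∫⁻ p in {p ∈ M | f p ∈ B}, h p ∂lam := by
    intro B hB
    rw [hν, Measure.map_apply hfm hB, withDensity_apply _ (hfm hB),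
      Measure.restrict_restrict (hfm hB), inter_comm]
    rfl
  -- By uniqueness it is enough that the weighted image measure is itself Riemannian.
  suffices hRM : IsRiemannianMeasure k d N (transportedTopology N g) ν by
    rw [hlam'.eq hN hRM, hνB B hB]
  refine ⟨?_, ?_⟩
  · rw [hνB _ hN.measurableSet.compl]
    have : {p | p ∈ M ∧ f p ∈ Nᶜ} = ∅ :=
      eq_empty_of_forall_notMem fun p hp => hp.2 (hf hp.1)
    rw [this, Measure.restrict_empty, lintegral_zero_measure]
  · intro V φ hφ A hA hAm
    have hψ := hφ.lift hk himm hinv hf hg hM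
    rw [hνB _ (hφ.measurableSet_image hA hAm)]
    have hset : {p | p ∈ M ∧ f p ∈ φ '' A} = (g ∘ φ) '' A := by
      ext p
      constructor
      · rintro ⟨hp, x, hx, hxp⟩
        exact ⟨x, hx, by rw [Function.comp_apply, hxp, hinv.1 hp]⟩
      · rintro ⟨x, hx, rfl⟩
        exact ⟨hψ.mapsTo (hA hx), x, hx, (hinv.2 (hφ.mapsTo (hA hx))).symm⟩
    rw [hset, hlam.setLIntegral_image hk hψ hA hAm (hh.mono_measure (Measure.restrict_mono
      ((image_mono hA).trans hψ.mapsTo.image_subset) le_rfl))]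
    refine setLIntegral_congr_fun hAm fun x hx => ?_
    rw [← hD V _ hψ x (hA hx)]
    have hev : f ∘ g ∘ φ =ᶠ[𝓝 x] φ := by
      filter_upwards [hφ.isOpen.mem_nhds (hA hx)] with w hw using hinv.2 (hφ.mapsTo hw)
    unfold volumeDensity
    rw [hev.fderiv_eq]

end Transport

/-! ### Jacobian matrices and volume densities -/

section Jacobian

open Matrix

theorem jacobian_mulVec {a b : ℕ} (f : Eu a → Eu b) (x v : Eu a) :
    jacobian f x *ᵥ v.ofLp = (fderiv ℝ f x v).ofLp := by
  have hv : v = ∑ j, v j • EuclideanSpace.single j (1 : ℝ) := by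
    ext i
    simp [Pi.single_apply]
  conv_rhs => rw [hv]
  ext i
  simp [jacobian, Matrix.mulVec, dotProduct, mul_comm]

theorem jacobian_mulVec_injective {a b : ℕ} {f : Eu a → Eu b} {x : Eu a}
    (h : Function.Injective (fderiv ℝ f x)) : Function.Injective (jacobian f x).mulVec := by
  intro v w hvw
  have h1 := jacobian_mulVec f x (WithLp.toLp 2 v)
  have h2 := jacobian_mulVec f x (WithLp.toLp 2 w)
  have h3 : fderiv ℝ f x (WithLp.toLp 2 v) = fderiv ℝ f x (WithLp.toLp 2 w) := by
    apply WithLp.ofLp_injective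
    rw [← h1, ← h2]
    exact hvw
  exact WithLp.toLp_injective 2 (h h3)

theorem volumeDensity_eq_sqrt_det {d a : ℕ} (φ : Eu d → Eu a) (x : Eu d) :
    volumeDensity φ x = √((jacobian φ x)ᵀ * jacobian φ x).det := by
  unfold volumeDensity
  congr 2
  ext i j
  simp [PiLp.inner_apply, Matrix.mul_apply, jacobian, mul_comm]

variable {m q d : ℕ}

/-- The projection of `ℝ^(m+q)` onto the first factor. -/
def projFst (m q : ℕ) : EuProd m q →L[ℝ] Eu m := WithLp.fstL 2 ℝ (Eu m) (Eu q)

/-- The projection of `ℝ^(m+q)` onto the second factor. -/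
def projSnd (m q : ℕ) : EuProd m q →L[ℝ] Eu q := WithLp.sndL 2 ℝ (Eu m) (Eu q)

/-- The identity map from `ℝ^(m+q)` to the product with the sup norm. -/
def euProdEquiv (m q : ℕ) : EuProd m q ≃L[ℝ] Eu m × Eu q :=
  WithLp.prodContinuousLinearEquiv 2 ℝ (Eu m) (Eu q)

theorem ContinuousLinearMap.fderiv_comp_left {X Y Z : Type*} [NormedAddCommGroup X]
    [NormedSpace ℝ X] [NormedAddCommGroup Y] [NormedSpace ℝ Y] [NormedAddCommGroup Z]
    [NormedSpace ℝ Z] (f : Y →L[ℝ] Z) {ψ : X → Y} {x : X} (hψ : DifferentiableAt ℝ ψ x) :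
    fderiv ℝ (f ∘ ψ) x = f.comp (fderiv ℝ ψ x) := by
  rw [fderiv_comp x f.differentiableAt hψ, f.fderiv]

theorem volumeDensity_prod_eq_sqrt_det {ψ : Eu d → EuProd m q} {x : Eu d}
    (hψ : DifferentiableAt ℝ ψ x) :
    volumeDensity ψ x = √((jacobian (projFst m q ∘ ψ) x)ᵀ * jacobian (projFst m q ∘ ψ) x +
      (jacobian (projSnd m q ∘ ψ) x)ᵀ * jacobian (projSnd m q ∘ ψ) x).det := by
  have h1 := (projFst m q).fderiv_comp_left hψ
  have h2 := (projSnd m q).fderiv_comp_left hψ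
  unfold volumeDensity
  congr 2
  ext i j
  simp only [Matrix.of_apply, Matrix.add_apply, Matrix.mul_apply, Matrix.transpose_apply, jacobian,
    h1, h2, WithLp.prod_inner_apply, PiLp.inner_apply, ContinuousLinearMap.comp_apply]
  simp [mul_comm, projFst, projSnd]

end Jacobian

/-! ### The data generating manifold -/

section DataGenerating

open Matrix Topology Filter

variable {m n q : ℕ} {Υ : Set (Eu m)} {Θ : Set (Eu q)} {G : Eu m → Eu q → Eu n} {y : Eu n}

theorem contDiffAt_uncurry (hΥ : IsOpen Υ) (hΘ : IsOpen Θ) {k : WithTop ℕ∞}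
    (hG : ContDiffOn ℝ k (fun p : Eu m × Eu q => G p.1 p.2) (Υ ×ˢ Θ)) {u : Eu m} (hu : u ∈ Υ)
    {θ : Eu q} (hθ : θ ∈ Θ) : ContDiffAt ℝ k (fun p : Eu m × Eu q => G p.1 p.2) (u, θ) :=
  hG.contDiffAt ((hΥ.prod hΘ).mem_nhds ⟨hu, hθ⟩)

theorem hasFDerivAt_left {u : Eu m} {θ : Eu q}
    (h : DifferentiableAt ℝ (fun p : Eu m × Eu q => G p.1 p.2) (u, θ)) :
    HasFDerivAt (fun v => G v θ) ((fderiv ℝ (fun p : Eu m × Eu q => G p.1 p.2) (u, θ)).comp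
      (ContinuousLinearMap.inl ℝ (Eu m) (Eu q))) u :=
  HasFDerivAt.comp (g := fun p : Eu m × Eu q => G p.1 p.2) (f := fun v => (v, θ)) u
    h.hasFDerivAt (hasFDerivAt_prodMk_left u θ)

theorem hasFDerivAt_right {u : Eu m} {θ : Eu q}
    (h : DifferentiableAt ℝ (fun p : Eu m × Eu q => G p.1 p.2) (u, θ)) :
    HasFDerivAt (fun ϑ => G u ϑ) ((fderiv ℝ (fun p : Eu m × Eu q => G p.1 p.2) (u, θ)).comp
      (ContinuousLinearMap.inr ℝ (Eu m) (Eu q))) θ :=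
  HasFDerivAt.comp (g := fun p : Eu m × Eu q => G p.1 p.2) (f := fun ϑ => (u, ϑ)) θ
    h.hasFDerivAt (hasFDerivAt_prodMk_right u θ)

theorem ofLp_fderiv_uncurry {u : Eu m} {θ : Eu q}
    (h : DifferentiableAt ℝ (fun p : Eu m × Eu q => G p.1 p.2) (u, θ)) (v : Eu m) (w : Eu q) :
    (fderiv ℝ (fun p : Eu m × Eu q => G p.1 p.2) (u, θ) (v, w)).ofLp =
      gradU G u θ *ᵥ v.ofLp + gradTheta G u θ *ᵥ w.ofLp := by
  rw [gradU, gradTheta, jacobian_mulVec, jacobian_mulVec, (hasFDerivAt_left h).fderiv,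
    (hasFDerivAt_right h).fderiv, ← WithLp.ofLp_add]
  simp [← map_add]

theorem gradU_apply {u : Eu m} {θ : Eu q}
    (h : DifferentiableAt ℝ (fun p : Eu m × Eu q => G p.1 p.2) (u, θ)) (i : Fin n) (j : Fin m) :
    gradU G u θ i j = fderiv ℝ (fun p : Eu m × Eu q => G p.1 p.2) (u, θ)
      (EuclideanSpace.single j 1, 0) i := by
  rw [gradU, jacobian, (hasFDerivAt_left h).fderiv]
  rfl

theorem gradTheta_apply {u : Eu m} {θ : Eu q}
    (h : DifferentiableAt ℝ (fun p : Eu m × Eu q => G p.1 p.2) (u, θ)) (i : Fin n) (j : Fin q) :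
    gradTheta G u θ i j = fderiv ℝ (fun p : Eu m × Eu q => G p.1 p.2) (u, θ)
      (0, EuclideanSpace.single j 1) i := by
  rw [gradTheta, jacobian, (hasFDerivAt_right h).fderiv]
  rfl

/-- `G` as a function on `ℝ^(m+q)`. -/
def uncurryLp (G : Eu m → Eu q → Eu n) (p : EuProd m q) : Eu n := G p.fst p.snd

theorem isOpen_prodLp (hΥ : IsOpen Υ) (hΘ : IsOpen Θ) :
    IsOpen {p : EuProd m q | p.fst ∈ Υ ∧ p.snd ∈ Θ} :=
  (hΥ.prod hΘ).preimage (euProdEquiv m q).continuous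

theorem contDiffOn_uncurryLp {k : WithTop ℕ∞}
    (hG : ContDiffOn ℝ k (fun p : Eu m × Eu q => G p.1 p.2) (Υ ×ˢ Θ)) :
    ContDiffOn ℝ k (uncurryLp G) {p : EuProd m q | p.fst ∈ Υ ∧ p.snd ∈ Θ} :=
  hG.comp (euProdEquiv m q).contDiff.contDiffOn
    fun _ hp => hp

theorem ofLp_fderiv_uncurryLp {p : EuProd m q}
    (h : DifferentiableAt ℝ (fun p : Eu m × Eu q => G p.1 p.2) (p.fst, p.snd))
    (v : EuProd m q) :
    (fderiv ℝ (uncurryLp G) p v).ofLp =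
      gradU G p.fst p.snd *ᵥ v.fst.ofLp + gradTheta G p.fst p.snd *ᵥ v.snd.ofLp := by
  rw [← ofLp_fderiv_uncurry h]
  have h1 : fderiv ℝ (uncurryLp G) p =
      (fderiv ℝ (fun p : Eu m × Eu q => G p.1 p.2) (p.fst, p.snd)).comp
        (euProdEquiv m q : EuProd m q →L[ℝ] Eu m × Eu q) :=
    (euProdEquiv m q).comp_right_fderiv (f := fun p : Eu m × Eu q => G p.1 p.2)
  rw [h1]
  rfl

theorem Matrix.mulVec_surjective_of_rank_eq {A : Matrix (Fin n) (Fin m) ℝ} (h : A.rank = n) :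
    Function.Surjective A.mulVec := by
  have : LinearMap.range A.mulVecLin = ⊤ := by
    apply Submodule.eq_top_of_finrank_eq
    rw [Module.finrank_fin_fun]
    exact h
  exact LinearMap.range_eq_top.1 this

theorem fderiv_uncurryLp_surjective {p : EuProd m q}
    (h : DifferentiableAt ℝ (fun p : Eu m × Eu q => G p.1 p.2) (p.fst, p.snd))
    (hu : (gradU G p.fst p.snd).rank = n) : Function.Surjective (fderiv ℝ (uncurryLp G) p) := by
  intro z
  obtain ⟨v, hv⟩ := Matrix.mulVec_surjective_of_rank_eq hu z.ofLp
  refine ⟨WithLp.toLp 2 (WithLp.toLp 2 v, 0), WithLp.ofLp_injective _ ?_⟩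
  rw [ofLp_fderiv_uncurryLp h]
  simpa using hv

theorem finrank_euProd (m q : ℕ) : Module.finrank ℝ (EuProd m q) = m + q := by
  rw [(WithLp.linearEquiv 2 ℝ (Eu m × Eu q)).finrank_eq, Module.finrank_prod]
  simp

theorem isEmbeddedSubmanifold_dataManifold {k : WithTop ℕ∞} (hk : k ≠ 0) (hΥ : IsOpen Υ)
    (hΘ : IsOpen Θ) (hG : ContDiffOn ℝ k (fun p : Eu m × Eu q => G p.1 p.2) (Υ ×ˢ Θ))
    (hu : ∀ u ∈ Υ, ∀ θ ∈ Θ, (gradU G u θ).rank = n) (y : Eu n) :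
    IsEmbeddedSubmanifold k (m + q - n) (dataManifold Υ Θ G y) := by
  have h := isEmbeddedSubmanifold_levelSet hk (isOpen_prodLp hΥ hΘ) (contDiffOn_uncurryLp hG)
    (fun p hp => fderiv_uncurryLp_surjective
      ((contDiffAt_uncurry hΥ hΘ hG hp.1 hp.2).differentiableAt hk) (hu _ hp.1 _ hp.2)) y
  rw [finrank_euProd] at h
  convert! h using 1
  ext p
  simp only [dataManifold, uncurryLp, mem_ofPred_eq, and_assoc]

theorem thetaHat_spec {u : Eu m} (hy : ∃! θ, IsMinimizer Θ G y u θ) :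
    IsMinimizer Θ G y u (thetaHat Θ G y u) :=
  Classical.epsilon_spec hy.exists

/-- A zero of the residual minimizes its norm, and the minimizer is unique. -/
theorem thetaHat_eq {u : Eu m} (hy : ∃! θ, IsMinimizer Θ G y u θ) {θ : Eu q} (hθ : θ ∈ Θ)
    (h : G u θ = y) : thetaHat Θ G y u = θ := by
  refine hy.unique (thetaHat_spec hy) ⟨hθ, fun ϑ _ => ?_⟩
  simp [h]

theorem mem_uProjection_iff (hy : ∀ u ∈ Υ, ∃! θ, IsMinimizer Θ G y u θ) {u : Eu m} :
    u ∈ uProjection Υ Θ G y ↔ u ∈ Υ ∧ G u (thetaHat Θ G y u) = y := by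
  refine and_congr_right fun hu => ⟨?_, fun h => ⟨⟨_, (thetaHat_spec (hy u hu)).1, by simp [h]⟩, ?_⟩⟩
  · rintro ⟨⟨θ, hθ, h0⟩, -⟩
    have h1 : G u θ = y := sub_eq_zero.1 (norm_eq_zero.1 h0)
    rwa [thetaHat_eq (hy u hu) hθ h1]
  · rintro _ ⟨ϑ, -, rfl⟩
    exact norm_nonneg _

theorem mapsTo_fst (hy : ∀ u ∈ Υ, ∃! θ, IsMinimizer Θ G y u θ) :
    MapsTo (projFst m q) (dataManifold Υ Θ G y) (uProjection Υ Θ G y) := by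
  intro p hp
  refine (mem_uProjection_iff hy).2 ⟨hp.1, ?_⟩
  have : thetaHat Θ G y p.fst = p.snd := thetaHat_eq (hy _ hp.1) hp.2.1 hp.2.2
  change G p.fst (thetaHat Θ G y p.fst) = y
  rw [this]
  exact hp.2.2

theorem mapsTo_graph (hy : ∀ u ∈ Υ, ∃! θ, IsMinimizer Θ G y u θ) :
    MapsTo (fun u => (WithLp.toLp 2 (u, thetaHat Θ G y u) : EuProd m q))
      (uProjection Υ Θ G y) (dataManifold Υ Θ G y) := fun u hu =>
  ⟨hu.1, (thetaHat_spec (hy u hu.1)).1, ((mem_uProjection_iff hy).1 hu).2⟩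

theorem invOn_graph_fst (hy : ∀ u ∈ Υ, ∃! θ, IsMinimizer Θ G y u θ) :
    InvOn (fun u => (WithLp.toLp 2 (u, thetaHat Θ G y u) : EuProd m q))
      (projFst m q) (dataManifold Υ Θ G y) (uProjection Υ Θ G y) := by
  refine ⟨fun p hp => ?_, fun u _ => rfl⟩
  have : thetaHat Θ G y p.fst = p.snd := thetaHat_eq (hy _ hp.1) hp.2.1 hp.2.2
  change WithLp.toLp 2 (p.fst, thetaHat Θ G y p.fst) = p
  rw [this]
  rfl

theorem continuousOn_graph_iff {s : Set (Eu m)} {f : Eu m → Eu q} :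
    ContinuousOn (fun u => (WithLp.toLp 2 (u, f u) : EuProd m q)) s ↔ ContinuousOn f s :=
  ⟨fun h => (projSnd m q).continuous.comp_continuousOn h, fun h =>
    (euProdEquiv m q).symm.continuous.comp_continuousOn
      (continuousOn_id.prodMk h)⟩

/-- A local parametrization of `𝒢(y)` has its tangent vectors in the kernel of the derivative of
`G`. -/
theorem fderiv_uncurryLp_comp_eq_zero {k : WithTop ℕ∞} (hk : k ≠ 0) {d : ℕ}
    {t : TopologicalSpace (dataManifold Υ Θ G y)} (hΥ : IsOpen Υ)
    (hΘ : IsOpen Θ) (hG : ContDiffOn ℝ k (fun p : Eu m × Eu q => G p.1 p.2) (Υ ×ˢ Θ))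
    {V : Set (Eu d)} {ψ : Eu d → EuProd m q} (hψ : IsLocalParam k d (dataManifold Υ Θ G y) t V ψ)
    {x : Eu d} (hx : x ∈ V) (v : Eu d) :
    fderiv ℝ (uncurryLp G) (ψ x) (fderiv ℝ ψ x v) = 0 := by
  have hp := hψ.mapsTo hx
  have hd : DifferentiableAt ℝ (uncurryLp G) (ψ x) :=
    ((contDiffOn_uncurryLp hG).contDiffAt
      ((isOpen_prodLp hΥ hΘ).mem_nhds ⟨hp.1, hp.2.1⟩)).differentiableAt hk
  have h1 := hd.hasFDerivAt.comp x ((hψ.contDiffAt hx).differentiableAt hk).hasFDerivAt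
  have h2 : HasFDerivAt (uncurryLp G ∘ ψ) (0 : Eu d →L[ℝ] Eu n) x := by
    refine (hasFDerivAt_const y x).congr_of_eventuallyEq ?_
    filter_upwards [hψ.isOpen.mem_nhds hx] with w hw using (hψ.mapsTo hw).2.2
  exact DFunLike.congr_fun (h1.unique h2) v

/-- A tangent vector with zero u-component is some (0, w) with ∇_θ G w = 0, and full column rank
gives w = 0. -/
theorem immersesTangent_fst {k : WithTop ℕ∞} (hk : k ≠ 0) {d : ℕ} (hΥ : IsOpen Υ)
    (hΘ : IsOpen Θ) (hG : ContDiffOn ℝ k (fun p : Eu m × Eu q => G p.1 p.2) (Υ ×ˢ Θ))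
    (hθ : ∀ u ∈ Υ, ∀ θ ∈ Θ, (gradTheta G u θ).rank = q) :
    ImmersesTangent k d (dataManifold Υ Θ G y) (projFst m q) := by
  intro V ψ hψ x hx v hv
  have hp := hψ.mapsTo hx
  have h0 := congrArg WithLp.ofLp (fderiv_uncurryLp_comp_eq_zero hk hΥ hΘ hG hψ hx v)
  rw [ofLp_fderiv_uncurryLp
    ((contDiffAt_uncurry hΥ hΘ hG hp.1 hp.2.1).differentiableAt hk)] at h0
  have hfst : (fderiv ℝ ψ x v).fst = 0 := hv
  rw [hfst, WithLp.ofLp_zero, Matrix.mulVec_zero, zero_add, WithLp.ofLp_zero] at h0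
  have hinj := Matrix.mulVec_injective_of_rank_eq_card
    (A := gradTheta G (ψ x).fst (ψ x).snd) (by simpa using hθ _ hp.1 _ hp.2.1)
  have hsnd : (fderiv ℝ ψ x v).snd = 0 := by
    apply WithLp.ofLp_injective
    apply hinj
    rw [h0, WithLp.ofLp_zero, Matrix.mulVec_zero]
  have hz : fderiv ℝ ψ x v = 0 := by
    apply WithLp.ofLp_injective
    exact Prod.ext hfst hsnd
  exact hψ.immersion x hx (hz.trans (map_zero _).symm)

theorem volumeDensity_fst_comp {k : WithTop ℕ∞} (hk : k ≠ 0) (hΥ : IsOpen Υ)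
    (hΘ : IsOpen Θ) (hG : ContDiffOn ℝ k (fun p : Eu m × Eu q => G p.1 p.2) (Υ ×ˢ Θ))
    (hu : ∀ u ∈ Υ, ∀ θ ∈ Θ, (gradU G u θ).rank = n)
    (hθ : ∀ u ∈ Υ, ∀ θ ∈ Θ, (gradTheta G u θ).rank = q)
    {V : Set (Eu (m + q - n))} {ψ : Eu (m + q - n) → EuProd m q}
    (hψ : IsLocalParam k (m + q - n) (dataManifold Υ Θ G y)
      (subspaceTopology (dataManifold Υ Θ G y)) V ψ)
    {x : Eu (m + q - n)} (hx : x ∈ V) :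
    volumeDensity (projFst m q ∘ ψ) x =
      volumeDensity ψ x * Dterm G (ψ x).fst (ψ x).snd ^ (-(1 / 2) : ℝ) := by
  have hp := hψ.mapsTo hx
  have hd := (contDiffAt_uncurry hΥ hΘ hG hp.1 hp.2.1).differentiableAt hk
  have hψd := (hψ.contDiffAt hx).differentiableAt hk
  have hA : (gradU G (ψ x).fst (ψ x).snd).rank = Fintype.card (Fin n) := by
    simpa using hu _ hp.1 _ hp.2.1
  have hB : (gradTheta G (ψ x).fst (ψ x).snd).rank = Fintype.card (Fin q) := by
    simpa using hθ _ hp.1 _ hp.2.1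
  have hfst := (projFst m q).fderiv_comp_left hψd
  have hsnd := (projSnd m q).fderiv_comp_left hψd
  have hJ₁ : ∀ v : Eu (m + q - n), jacobian (projFst m q ∘ ψ) x *ᵥ v.ofLp =
      (fderiv ℝ ψ x v).fst.ofLp := fun v => by rw [jacobian_mulVec, hfst]; rfl
  have hJ₂ : ∀ v : Eu (m + q - n), jacobian (projSnd m q ∘ ψ) x *ᵥ v.ofLp =
      (fderiv ℝ ψ x v).snd.ofLp := fun v => by rw [jacobian_mulVec, hsnd]; rfl
  have htan := fderiv_uncurryLp_comp_eq_zero hk hΥ hΘ hG hψ hx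
  -- The tangent space lies in the kernel of DG, and both have dimension m + q - n.
  have hker : LinearMap.range (fderiv ℝ ψ x : Eu (m + q - n) →ₗ[ℝ] EuProd m q) =
      LinearMap.ker (fderiv ℝ (uncurryLp G) (ψ x) : EuProd m q →ₗ[ℝ] Eu n) := by
    apply Submodule.eq_of_le_of_finrank_eq
    · rintro _ ⟨v, rfl⟩
      exact htan v
    · have h1 := LinearMap.finrank_range_add_finrank_ker
        (fderiv ℝ (uncurryLp G) (ψ x) : EuProd m q →ₗ[ℝ] Eu n)
      rw [LinearMap.range_eq_top.2 (fderiv_uncurryLp_surjective hd (hu _ hp.1 _ hp.2.1)),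
        finrank_top, finrank_euclideanSpace_fin, finrank_euProd] at h1
      rw [LinearMap.finrank_range_of_inj (hψ.immersion x hx), finrank_euclideanSpace_fin]
      omega
  have hdet := det_gram_add hA hB
    (P₁ := jacobian (projFst m q ∘ ψ) x)
    (P₂ := jacobian (projSnd m q ∘ ψ) x) ?_ ?_ ?_
  · have hDpos : 0 < Dterm G (ψ x).fst (ψ x).snd := det_one_add_inv_pos hA _
    rw [volumeDensity_eq_sqrt_det, volumeDensity_prod_eq_sqrt_det hψd, hdet]
    change _ = √(_ * Dterm G (ψ x).fst (ψ x).snd) * _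
    rw [Real.sqrt_mul' _ hDpos.le, Real.rpow_neg hDpos.le, ← Real.sqrt_eq_rpow, mul_assoc,
      mul_inv_cancel₀ (Real.sqrt_pos.2 hDpos).ne', mul_one]
  · apply Matrix.ext_of_mulVec_single
    intro j
    have h1 := congrArg WithLp.ofLp (htan (EuclideanSpace.single j 1))
    rw [ofLp_fderiv_uncurryLp hd, ← hJ₁, ← hJ₂, Matrix.mulVec_mulVec, Matrix.mulVec_mulVec,
      ← Matrix.add_mulVec] at h1
    rw [Matrix.zero_mulVec]
    exact h1
  · apply jacobian_mulVec_injective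
    rw [hfst, injective_iff_map_eq_zero]
    exact fun v hv => immersesTangent_fst hk hΥ hΘ hG hθ V ψ hψ x hx v hv
  · intro v w hvw
    have h1 : (WithLp.toLp 2 (WithLp.toLp 2 v, WithLp.toLp 2 w) : EuProd m q) ∈
        LinearMap.range (fderiv ℝ ψ x : Eu (m + q - n) →ₗ[ℝ] EuProd m q) := by
      rw [hker]
      apply WithLp.ofLp_injective
      exact (ofLp_fderiv_uncurryLp hd _).trans hvw
    obtain ⟨r, hr⟩ := h1
    have hr' : fderiv ℝ ψ x r = WithLp.toLp 2 (WithLp.toLp 2 v, WithLp.toLp 2 w) := hr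
    refine ⟨r.ofLp, ?_, ?_⟩
    · rw [hJ₁, hr']
      rfl
    · rw [hJ₂, hr']
      rfl

theorem ContinuousOn.matrix_inv' {X : Type*} [TopologicalSpace X] {o : Type*} [Fintype o]
    [DecidableEq o] {s : Set X} {A : X → Matrix o o ℝ} (hA : ContinuousOn A s)
    (h : ∀ x ∈ s, IsUnit (A x).det) : ContinuousOn (fun x => (A x)⁻¹) s := by
  have hdet : Continuous fun N : Matrix o o ℝ => N.det := continuous_id.matrix_det
  have hadj : Continuous fun N : Matrix o o ℝ => N.adjugate := continuous_id.matrix_adjugate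
  simp only [Matrix.inv_def, Ring.inverse_eq_inv']
  exact ((hdet.comp_continuousOn hA).inv₀ fun x hx => (h x hx).ne_zero).smul
    (hadj.comp_continuousOn hA)

/-- This serves the measurability of the weight D^(-1/2) on 𝒢(y). -/
theorem continuousOn_Dterm {k : WithTop ℕ∞} (hk : k ≠ 0) (hΥ : IsOpen Υ) (hΘ : IsOpen Θ)
    (hG : ContDiffOn ℝ k (fun p : Eu m × Eu q => G p.1 p.2) (Υ ×ˢ Θ))
    (hu : ∀ u ∈ Υ, ∀ θ ∈ Θ, (gradU G u θ).rank = n)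
    (hθ : ∀ u ∈ Υ, ∀ θ ∈ Θ, (gradTheta G u θ).rank = q) :
    ContinuousOn (fun p : Eu m × Eu q => Dterm G p.1 p.2) (Υ ×ˢ Θ) := by
  have hD : ContinuousOn (fderiv ℝ fun p : Eu m × Eu q => G p.1 p.2) (Υ ×ˢ Θ) :=
    hG.continuousOn_fderiv_of_isOpen (hΥ.prod hΘ) (ENat.one_le_iff_ne_zero_withTop.2 hk)
  have hdiff : ∀ p ∈ Υ ×ˢ Θ, DifferentiableAt ℝ (fun p : Eu m × Eu q => G p.1 p.2) (p.1, p.2) :=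
    fun p hp => (contDiffAt_uncurry hΥ hΘ hG hp.1 hp.2).differentiableAt hk
  have hAc : ContinuousOn (fun p : Eu m × Eu q => gradU G p.1 p.2) (Υ ×ˢ Θ) := by
    refine continuousOn_pi.2 fun i => continuousOn_pi.2 fun j => ?_
    refine ContinuousOn.congr ?_ fun p hp => gradU_apply (hdiff p hp) i j
    exact (EuclideanSpace.proj (𝕜 := ℝ) i : Eu n →L[ℝ] ℝ).continuous.comp_continuousOn
      (hD.clm_apply continuousOn_const)
  have hBc : ContinuousOn (fun p : Eu m × Eu q => gradTheta G p.1 p.2) (Υ ×ˢ Θ) := by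
    refine continuousOn_pi.2 fun i => continuousOn_pi.2 fun j => ?_
    refine ContinuousOn.congr ?_ fun p hp => gradTheta_apply (hdiff p hp) i j
    exact (EuclideanSpace.proj (𝕜 := ℝ) i : Eu n →L[ℝ] ℝ).continuous.comp_continuousOn
      (hD.clm_apply continuousOn_const)
  have hA : ∀ p ∈ Υ ×ˢ Θ, (gradU G p.1 p.2).rank = Fintype.card (Fin n) := fun p hp => by
    simpa using hu _ hp.1 _ hp.2
  have hB : ∀ p ∈ Υ ×ˢ Θ, (gradTheta G p.1 p.2).rank = Fintype.card (Fin q) := fun p hp => by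
    simpa using hθ _ hp.1 _ hp.2
  have hT : ∀ a b : ℕ, Continuous fun N : Matrix (Fin a) (Fin b) ℝ => Nᵀ := fun a b =>
    continuous_id.matrix_transpose
  have hM : ∀ {a b c : ℕ} {f : Eu m × Eu q → Matrix (Fin a) (Fin b) ℝ}
      {g : Eu m × Eu q → Matrix (Fin b) (Fin c) ℝ}, ContinuousOn f (Υ ×ˢ Θ) →
      ContinuousOn g (Υ ×ˢ Θ) → ContinuousOn (fun p => f p * g p) (Υ ×ˢ Θ) := by
    intro a b c f g hf hg
    have : Continuous fun N : Matrix (Fin a) (Fin b) ℝ × Matrix (Fin b) (Fin c) ℝ => N.1 * N.2 :=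
      continuous_fst.matrix_mul continuous_snd
    exact this.comp_continuousOn (hf.prodMk hg)
  have hdet : Continuous fun N : Matrix (Fin q) (Fin q) ℝ => N.det := continuous_id.matrix_det
  refine hdet.comp_continuousOn (continuousOn_const.add (ContinuousOn.matrix_inv' ?_ fun p hp =>
    isUnit_det_transpose_mul_inv_mul (hA p hp) (hB p hp)))
  refine hM (hM ((hT _ _).comp_continuousOn hBc) (ContinuousOn.matrix_inv'
    (hM hAc ((hT _ _).comp_continuousOn hAc)) fun p hp => isUnit_det_mul_transpose (hA p hp))) hBc

/-- By dimension count the columns of N span the orthogonal complement of the column space of A; r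
lies in this complement and is orthogonal to it. -/
theorem IsOrthonormalComplement.eq_zero {A : Matrix (Fin n) (Fin q) ℝ} (hA : A.rank = q)
    {N : Matrix (Fin n) (Fin (n - q)) ℝ} (hN : IsOrthonormalComplement A N) {r : Eu n}
    (hAr : Aᵀ *ᵥ r.ofLp = 0) (hNr : Nᵀ *ᵥ r.ofLp = 0) : r = 0 := by
  let b : Fin (n - q) → Eu n := fun j => WithLp.toLp 2 (N.col j)
  set W : Submodule ℝ (Eu n) :=
    Submodule.span ℝ (range fun j => (WithLp.toLp 2 (A.col j) : Eu n)) with hW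
  have horth : ∀ {c : ℕ} (C : Matrix (Fin n) (Fin c) ℝ) {v : Eu n}, Cᵀ *ᵥ v.ofLp = 0 →
      v ∈ (Submodule.span ℝ (range fun j => (WithLp.toLp 2 (C.col j) : Eu n)))ᗮ := by
    intro c C v hv
    rw [Submodule.mem_orthogonal]
    intro w hw
    induction hw using Submodule.span_induction with
    | mem w hw =>
      obtain ⟨j, rfl⟩ := hw
      rw [inner_toLp_col, hv, Pi.zero_apply]
    | zero => exact inner_zero_left _
    | add a b _ _ ha hb => rw [inner_add_left, ha, hb, add_zero]
    | smul a b _ hb => rw [inner_smul_left, hb, mul_zero]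
  have hb : Orthonormal ℝ b := by
    rw [orthonormal_iff_ite]
    intro i j
    rw [inner_toLp_col, ← Matrix.one_apply, ← hN.1]
    rfl
  have hWd : Module.finrank ℝ W = q := by
    rw [hW, finrank_span_eq_card (linearIndependent_toLp_col hA), Fintype.card_fin]
  have hspan : Submodule.span ℝ (range b) = Wᗮ := by
    apply Submodule.eq_of_le_of_finrank_eq
    · rw [Submodule.span_le]
      rintro _ ⟨j, rfl⟩
      apply horth A
      ext i
      exact congrFun (congrFun hN.2 i) j
    · rw [finrank_span_eq_card hb.linearIndependent, Fintype.card_fin]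
      have := W.finrank_add_finrank_orthogonal
      rw [finrank_euclideanSpace_fin, hWd] at this
      omega
  have h1 : r ∈ Submodule.span ℝ (range b) := hspan ▸ horth A hAr
  have h2 : r ∈ (Submodule.span ℝ (range b))ᗮ := horth N hNr
  exact inner_self_eq_zero.1 (Submodule.inner_right_of_mem_orthogonal h1 h2)

/-- The first order condition for the minimizer. -/
theorem gradTheta_transpose_mulVec_eq_zero (hΘ : IsOpen Θ) {u : Eu m} {θ : Eu q}
    (hd : DifferentiableAt ℝ (fun p : Eu m × Eu q => G p.1 p.2) (u, θ))
    (h : IsMinimizer Θ G y u θ) : (gradTheta G u θ)ᵀ *ᵥ (G u θ - y).ofLp = 0 := by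
  have hdr := hasFDerivAt_right hd
  -- The norm is squared because it is not differentiable where the residual vanishes.
  have hmin : IsLocalMin (fun ϑ => ‖G u ϑ - y‖ ^ 2) θ := by
    filter_upwards [hΘ.mem_nhds h.1] with ϑ hϑ
    exact pow_le_pow_left₀ (norm_nonneg _) (h.2 hϑ) 2
  have h0 := hmin.hasFDerivAt_eq_zero (hdr.sub_const y).norm_sq
  ext j
  have h1 := DFunLike.congr_fun h0 (EuclideanSpace.single j 1)
  have h2 : inner ℝ (G u θ - y) (fderiv ℝ (fun p : Eu m × Eu q => G p.1 p.2) (u, θ)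
      (0, EuclideanSpace.single j 1)) = 0 := by
    simpa [inner_sub_left] using h1
  rw [← inner_toLp_col, real_inner_comm, Pi.zero_apply, ← h2]
  congr 1
  ext i
  exact gradTheta_apply hd i j

theorem contDiffAt_gradTheta_col (hΥ : IsOpen Υ) (hΘ : IsOpen Θ)
    (hG : ContDiffOn ℝ 3 (fun p : Eu m × Eu q => G p.1 p.2) (Υ ×ˢ Θ)) {u : Eu m} (hu : u ∈ Υ)
    {θ : Eu q} (hθ : θ ∈ Θ) (j : Fin q) :
    ContDiffAt ℝ 2 (fun p : Eu m × Eu q =>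
      (WithLp.toLp 2 ((gradTheta G p.1 p.2).col j) : Eu n)) (u, θ) := by
  have h1 : ContDiffAt ℝ 2 (fun p => fderiv ℝ (fun p : Eu m × Eu q => G p.1 p.2) p
      (0, EuclideanSpace.single j 1)) (u, θ) :=
    ((contDiffAt_uncurry hΥ hΘ hG hu hθ).fderiv_right (m := 2) (by norm_num)).clm_apply
      contDiffAt_const
  refine h1.congr_of_eventuallyEq ?_
  filter_upwards [(hΥ.prod hΘ).mem_nhds ⟨hu, hθ⟩] with p hp
  ext i
  exact gradTheta_apply ((contDiffAt_uncurry hΥ hΘ hG hp.1 hp.2).differentiableAt (by norm_num)) i j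

theorem exists_smooth_orthonormalComplement (hΥ : IsOpen Υ) (hΘ : IsOpen Θ)
    (hG : ContDiffOn ℝ 3 (fun p : Eu m × Eu q => G p.1 p.2) (Υ ×ˢ Θ))
    (hθ : ∀ u ∈ Υ, ∀ θ ∈ Θ, (gradTheta G u θ).rank = q) {u₀ : Eu m} (hu₀ : u₀ ∈ Υ) {θ₀ : Eu q}
    (hθ₀ : θ₀ ∈ Θ) :
    ∃ N : Eu m → Eu q → Matrix (Fin n) (Fin (n - q)) ℝ,
      (∀ u ∈ Υ, ∀ θ ∈ Θ, IsOrthonormalComplement (gradTheta G u θ) (N u θ)) ∧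
      ∃ O : Set (Eu m × Eu q), IsOpen O ∧ (u₀, θ₀) ∈ O ∧
        ∀ i j, ContDiffOn ℝ 2 (fun p : Eu m × Eu q => N p.1 p.2 i j) O := by
  classical
  obtain ⟨O, N₁, hO, hmem, hN₁, hN₁c⟩ := exists_contDiffOn_orthonormal_compl (by decide)
    (contDiffAt_gradTheta_col hΥ hΘ hG hu₀ hθ₀) (hθ u₀ hu₀ θ₀ hθ₀)
  -- Outside the neighbourhood `O` smoothness is not required, so an arbitrary pointwise complement
  -- completes the choice.
  have hex : ∀ p : Eu m × Eu q, ∃ N : Matrix (Fin n) (Fin (n - q)) ℝ,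
      p ∈ Υ ×ˢ Θ → IsOrthonormalComplement (gradTheta G p.1 p.2) N := by
    intro p
    by_cases hp : p ∈ Υ ×ˢ Θ
    · obtain ⟨b, hb, hAb⟩ := exists_orthonormal_compl (hθ _ hp.1 _ hp.2)
      exact ⟨_, fun _ => isOrthonormalComplement_of hb hAb⟩
    · exact ⟨0, fun h => absurd h hp⟩
  choose N₂ hN₂ using hex
  refine ⟨fun u θ => if (u, θ) ∈ O then N₁ (u, θ) else N₂ (u, θ), fun u hu θ hθ' => ?_, O, hO, hmem,
    fun i j => (hN₁c i j).congr fun p hp => ?_⟩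
  · by_cases h : (u, θ) ∈ O
    · simpa only [if_pos h] using hN₁ _ h
    · simpa only [if_neg h] using hN₂ (u, θ) ⟨hu, hθ'⟩
  · simp only [Prod.mk.eta, if_pos hp]

end DataGenerating

end

/-! ### The main theorem -/

theorem lemma1 {m n q : ℕ} (Υ : Set (Eu m)) (Θ : Set (Eu q)) (hΥ : IsOpen Υ) (hΘ : IsOpen Θ)
    (G : Eu m → Eu q → Eu n)
    (hG : ContDiffOn ℝ 3 (fun p : Eu m × Eu q => G p.1 p.2) (Υ ×ˢ Θ))
    (hu : ∀ u ∈ Υ, ∀ θ ∈ Θ, (gradU G u θ).rank = n)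
    (hθ : ∀ u ∈ Υ, ∀ θ ∈ Θ, (gradTheta G u θ).rank = q)
    (y : Eu n)
    (hy : ∀ u ∈ Υ, ∃! θ, IsMinimizer Θ G y u θ) :
    -- `𝒢(y)` is an embedded submanifold, and it is the graph of `θ̂(y, ·)` over `𝒰(y)`
    IsEmbeddedSubmanifold 2 (m + q - n) (dataManifold Υ Θ G y) ∧
    dataManifold Υ Θ G y =
      (fun u => (WithLp.toLp 2 (u, thetaHat Θ G y u) : EuProd m q)) '' uProjection Υ Θ G y ∧
    -- `𝒰(y)` is a level set, for every choice of the orthonormal complement of `∇_θ G`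
    (∀ N : Eu m → Eu q → Matrix (Fin n) (Fin (n - q)) ℝ,
      (∀ u ∈ Υ, ∀ θ ∈ Θ, IsOrthonormalComplement (gradTheta G u θ) (N u θ)) →
      uProjection Υ Θ G y =
        {u | u ∈ Υ ∧ (N u (thetaHat Θ G y u)).transpose.mulVec
          (G u (thetaHat Θ G y u) - y).ofLp = 0}) ∧
    -- around every point the orthonormal complement can be chosen to vary smoothly
    (∀ u₀ ∈ Υ, ∀ θ₀ ∈ Θ, ∃ N : Eu m → Eu q → Matrix (Fin n) (Fin (n - q)) ℝ,
      (∀ u ∈ Υ, ∀ θ ∈ Θ, IsOrthonormalComplement (gradTheta G u θ) (N u θ)) ∧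
      ∃ O : Set (Eu m × Eu q), IsOpen O ∧ (u₀, θ₀) ∈ O ∧
        ∀ i j, ContDiffOn ℝ 2 (fun p : Eu m × Eu q => N p.1 p.2 i j) O) ∧
    -- `𝒰(y)` is a submanifold isomorphic to `𝒢(y)`
    ∃ t : TopologicalSpace (uProjection Υ Θ G y),
      IsSubmanifold 2 (m + q - n) (uProjection Υ Θ G y) t ∧
      IsCkDiffeo 2 (m + q - n)
        (dataManifold Υ Θ G y) (subspaceTopology (dataManifold Υ Θ G y))
        (uProjection Υ Θ G y) t
        (fun p => p.fst) (fun u => WithLp.toLp 2 (u, thetaHat Θ G y u)) ∧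
      -- `𝒰(y)` is embedded exactly when `θ̂(y, ·)` is continuous on it
      (t = subspaceTopology (uProjection Υ Θ G y) ↔
        ContinuousOn (thetaHat Θ G y) (uProjection Υ Θ G y)) ∧
      -- the intrinsic measures and their relation
      (∃! lamG : Measure (EuProd m q), IsRiemannianMeasure 2 (m + q - n)
        (dataManifold Υ Θ G y) (subspaceTopology (dataManifold Υ Θ G y)) lamG) ∧
      (∃! lamU : Measure (Eu m), IsRiemannianMeasure 2 (m + q - n)
        (uProjection Υ Θ G y) t lamU) ∧
      ∀ (lamG : Measure (EuProd m q)) (lamU : Measure (Eu m)),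
        IsRiemannianMeasure 2 (m + q - n)
          (dataManifold Υ Θ G y) (subspaceTopology (dataManifold Υ Θ G y)) lamG →
        IsRiemannianMeasure 2 (m + q - n) (uProjection Υ Θ G y) t lamU →
        ∀ B : Set (Eu m), MeasurableSet B →
          lamU B = ∫⁻ p in {p ∈ dataManifold Υ Θ G y | p.fst ∈ B},
            ENNReal.ofReal (Dterm G p.fst p.snd ^ (-(1 / 2) : ℝ)) ∂lamG := by
  have hG2 : ContDiffOn ℝ 2 (fun p : Eu m × Eu q => G p.1 p.2) (Υ ×ˢ Θ) := hG.of_le (by norm_num)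
  have h2 : (2 : WithTop ℕ∞) ≠ 0 := by norm_num
  have hM := isEmbeddedSubmanifold_dataManifold h2 hΥ hΘ hG2 hu y
  have hinv := invOn_graph_fst (Υ := Υ) hy
  have hf := mapsTo_fst (Υ := Υ) hy
  have hg := mapsTo_graph (Υ := Υ) hy
  have himm : ImmersesTangent 2 (m + q - n) (dataManifold Υ Θ G y) (projFst m q) :=
    immersesTangent_fst h2 hΥ hΘ hG2 hθ
  have hN := isSubmanifold_transported h2 himm hinv hf hg hM
  refine ⟨hM, ?_, ?_, ?_, transportedTopology _
    (fun u => (WithLp.toLp 2 (u, thetaHat Θ G y u) : EuProd m q)), hN,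
    isCkDiffeo_transported h2 himm hinv hf hg hM,
    (transportedTopology_eq_subspace_iff hinv).trans continuousOn_graph_iff,
    hM.existsUnique_isRiemannianMeasure h2, hN.existsUnique_isRiemannianMeasure h2, ?_⟩
  · exact Subset.antisymm (fun p hp => ⟨projFst m q p, hf hp, hinv.1 hp⟩) hg.image_subset
  · intro N hNc
    ext u
    rw [mem_uProjection_iff hy]
    refine and_congr_right fun huΥ => ⟨fun h => by simp [h], fun h => ?_⟩
    have hmin := thetaHat_spec (hy u huΥ)
    -- The first order condition kills the component of the residual along ∇_θ G; the assumed
    -- equation `h` kills the rest.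
    exact sub_eq_zero.1 ((hNc u huΥ _ hmin.1).eq_zero (hθ u huΥ _ hmin.1)
      (gradTheta_transpose_mulVec_eq_zero hΘ
        ((contDiffAt_uncurry hΥ hΘ hG huΥ hmin.1).differentiableAt (by norm_num)) hmin) h)
  · exact fun u₀ hu₀ θ₀ hθ₀ => exists_smooth_orthonormalComplement hΥ hΘ hG hθ hu₀ hθ₀
  · intro lamG lamU hlamG hlamU B hB
    refine hlamG.apply_transported h2 himm hinv hf hg hM hlamU ?_ (fun V ψ hψ x hx => ?_) hB
    · refine AEMeasurable.ennreal_ofReal (ContinuousOn.aemeasurable ?_ hM.measurableSet)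
      have hD : ContinuousOn (fun p : EuProd m q => Dterm G p.fst p.snd)
          (dataManifold Υ Θ G y) :=
        (continuousOn_Dterm h2 hΥ hΘ hG2 hu hθ).comp (euProdEquiv m q).continuous.continuousOn
          fun p hp => ⟨hp.1, hp.2.1⟩
      refine hD.rpow_const fun p hp => .inl (ne_of_gt ?_)
      exact det_one_add_inv_pos (by simpa using hu _ hp.1 _ hp.2.1) _
    · rw [volumeDensity_fst_comp h2 hΥ hΘ hG2 hu hθ hψ hx]
      exact ENNReal.ofReal_mul (Real.sqrt_nonneg _)
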